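/- Conventions. A pre-$\lambda$ ring is a commutative ring $R$ with operations $\sigma_k : R \to R$ ($k \ge 0$) such that $\sigma_t(r) = \sum_{k \ge 0} \sigma_k(r) t^k$ satisfies $\sigma_0(r) = 1$, $\sigma_1(r) = r$ and $\sigma_t(r+s) = \sigma_t(r)\sigma_t(s)$; a map of pre-$\lambda$ rings is a ring homomorphism commuting with all $\sigma_k$. For a commutative ring $R$, let $\Lambda_R^\wedge$ be the ring of symmetric power series over $R$ in variables $t_1, t_2, \ldots$ (power series, of possibly unbounded degree, invariant under all permutations of the variables), with elementary and complete symmetric functions $e_i, h_i \in \Lambda_R^\wedge$, and let $\mathrm{Fil}^1\Lambda_R^\wedge$ be the ideal of symmetric power series all of whose monomials have degree at least $1$. If $R$ is a pre-$\lambda$ ring, $\Lambda_R^\wedge$ is a pre-$\lambda$ ring through \[ \sigma_s\Big(\sum_I a_I t^I\Big) = \prod_I \sigma_{s\,t^I}(a_I), \] and for $f \in \mathrm{Fil}^1 \Lambda_R^\wedge$ one puts $\mathrm{Exp}_\sigma(f) = \sum_{k \ge 0} \sigma_k(f)$. Let $\omega$ be the continuous $R$-algebra endomorphism of $\Lambda_R^\wedge$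 with $\omega(e_i) = h_i$ for all $i \ge 1$, and let $\tilde\omega$ be the composition of $\omega$ with the degree flip, which acts as $(-1)^i$ on the component of degree $i$; so $\tilde\omega(e_i) = (-1)^i h_i$. Lemma. Let $R$ be a pre-$\lambda$ ring whose additive group is torsion-free. Then $\tilde\omega : \Lambda_R^\wedge \to \Lambda_R^\wedge$ is a map of pre-$\lambda$ rings. In particular, $\tilde\omega$ maps $\mathrm{Fil}^1 \Lambda_R^\wedge$ into itself and, for every $f \in \mathrm{Fil}^1 \Lambda_R^\wedge$, \[ \tilde\omega(\mathrm{Exp}_\sigma(f)) = \mathrm{Exp}_\sigma(\tilde\omega(f)). \] -/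

import Mathlib

open MvPowerSeries

/-- A pre-`λ` ring: a commutative ring with operations `σ k` such that
`σ_t(r) = ∑ k, σ k r * t ^ k` is a homomorphism from the additive group of `R` to `1 + t R⟦t⟧`
(under multiplication) with `σ_t(r) = 1 + r t + ⋯`. -/
class PreLambdaRing (R : Type*) [CommRing R] where
  /-- the `σ`-operations `σ k r = h_k ∘ r` -/
  σ : ℕ → R → R
  σ_zero : ∀ r, σ 0 r = 1
  σ_one : ∀ r, σ 1 r = r
  σ_add : ∀ n r s, σ n (r + s) = ∑ ij ∈ Finset.HasAntidiagonal.antidiagonal n, σ ij.1 r * σ ij.2 s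

/-- A map of pre-`λ` rings: a ring homomorphism commuting with all the operations `σ k`. -/
def IsPreLambdaHom {A B : Type*} [CommRing A] [CommRing B] [PreLambdaRing A] [PreLambdaRing B]
    (φ : A →+* B) : Prop :=
  ∀ (k : ℕ) (a : A), φ (PreLambdaRing.σ k a) = PreLambdaRing.σ k (φ a)

/-- The ring `Λ_R^∧` of symmetric power series: the formal power series in the variables
`t_0, t_1, t_2, …` over `R` (of possibly unbounded degree) that are fixed by all permutations of
the variables. -/
def SymPowerSeries (R : Type*) [CommRing R] : Subalgebra R (MvPowerSeries ℕ R) where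
  carrier := {f | ∀ e : Equiv.Perm ℕ, MvPowerSeries.rename e f = f}
  mul_mem' ha hb e := by rw [map_mul, ha, hb]
  add_mem' ha hb e := by rw [map_add, ha, hb]
  algebraMap_mem' r e := AlgHom.commutes _ r

namespace SymPowerSeries

variable {R : Type*} [CommRing R]

theorem coeff_mapDomain_rename (e : Equiv.Perm ℕ) (f : MvPowerSeries ℕ R) (J : ℕ →₀ ℕ) :
    coeff (J.mapDomain e) (rename e f) = coeff J f := by
  have := coeff_embDomain_rename e.toEmbedding f J
  rw [Finsupp.embDomain_eq_mapDomain] at this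
  exact this

theorem mem_iff {f : MvPowerSeries ℕ R} :
    f ∈ SymPowerSeries R ↔
      ∀ (e : Equiv.Perm ℕ) (J : ℕ →₀ ℕ), coeff (J.mapDomain e) f = coeff J f := by
  constructor
  · intro h e J
    conv_lhs => rw [← h e]
    exact coeff_mapDomain_rename e f J
  · intro h e
    ext J
    obtain ⟨J, rfl⟩ : ∃ J' : ℕ →₀ ℕ, J'.mapDomain e = J :=
      ⟨J.mapDomain e.symm, by rw [← Finsupp.mapDomain_comp]; simp⟩
    rw [coeff_mapDomain_rename, h]

theorem mk_mem (a : (ℕ →₀ ℕ) → R)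
    (h : ∀ (e : Equiv.Perm ℕ) (J : ℕ →₀ ℕ), a (J.mapDomain e) = a J) :
    (show MvPowerSeries ℕ R from a) ∈ SymPowerSeries R :=
  mem_iff.2 h

/-! ### The pre-`λ` structure on `Λ_R^∧` -/

section Sigma

variable [PreLambdaRing R]

theorem sigma_zero_right (n : ℕ) (hn : n ≠ 0) : PreLambdaRing.σ n (0 : R) = 0 := by
  induction n using Nat.strong_induction_on with
  | _ n ih =>
    have h := PreLambdaRing.σ_add n (0 : R) 0
    obtain ⟨m, rfl⟩ := Nat.exists_eq_succ_of_ne_zero hn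
    rw [add_zero, Finset.Nat.sum_antidiagonal_eq_sum_range_succ_mk, Finset.sum_range_succ,
      Finset.sum_range_succ', Finset.sum_eq_zero] at h
    · simpa [PreLambdaRing.σ_zero] using h
    · intro i hi
      have := Finset.mem_range.1 hi
      simp only
      rw [ih (i + 1) (by omega) (by omega), zero_mul]

/-- For `f = ∑ I, a_I t ^ I`, the factor `σ_{s t ^ I}(a_I) = ∑ c, σ c a_I * t ^ (c I) * s ^ c`,
a power series in `s` over `R⟦t_0, t_1, …⟧`. -/
noncomputable def sigmaFactor (f : MvPowerSeries ℕ R) (I : ℕ →₀ ℕ) :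
    PowerSeries (MvPowerSeries ℕ R) :=
  PowerSeries.mk fun c => MvPowerSeries.monomial (c • I) (PreLambdaRing.σ c (coeff I f))

/-- The coefficient of `s ^ k` in the infinite product `σ_s(f) = ∏ I, σ_{s t ^ I}(a_I)`, where
`f = ∑ I, a_I t ^ I`. The coefficient of `t ^ J` only involves the factors with `I ≤ J`, see
`coeff_prod_sigmaFactor`. -/
noncomputable def sigmaFun (k : ℕ) (f : MvPowerSeries ℕ R) : MvPowerSeries ℕ R :=
  fun J => coeff J (PowerSeries.coeff k (∏ I ∈ Finset.Iic J, sigmaFactor f I))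

theorem coeff_sigmaFun (k : ℕ) (f : MvPowerSeries ℕ R) (J : ℕ →₀ ℕ) :
    coeff J (sigmaFun k f) =
      coeff J (PowerSeries.coeff k (∏ I ∈ Finset.Iic J, sigmaFactor f I)) := rfl

theorem coeff_zero_sigmaFactor (f : MvPowerSeries ℕ R) (I : ℕ →₀ ℕ) :
    PowerSeries.coeff 0 (sigmaFactor f I) = 1 := by
  rw [sigmaFactor, PowerSeries.coeff_mk, PreLambdaRing.σ_zero, zero_smul]
  rfl

theorem coeff_sigmaFactor_mul (f : MvPowerSeries ℕ R) {I J : ℕ →₀ ℕ} (h : ¬ I ≤ J) (k : ℕ)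
    (P : PowerSeries (MvPowerSeries ℕ R)) :
    coeff J (PowerSeries.coeff k (sigmaFactor f I * P)) = coeff J (PowerSeries.coeff k P) := by
  classical
  rw [PowerSeries.coeff_mul, map_sum, Finset.sum_eq_single (0, k)]
  · simp only [coeff_zero_sigmaFactor, one_mul]
  · rintro ⟨c, l⟩ hcl hne
    have hc : c ≠ 0 := by
      rintro rfl
      simp only [Finset.HasAntidiagonal.mem_antidiagonal, zero_add] at hcl
      exact hne (by rw [hcl])
    have h' : ¬ c • I ≤ J := fun hle => h (le_trans (fun i => by
      simpa using Nat.le_mul_of_pos_left (I i) (Nat.pos_of_ne_zero hc)) hle)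
    simp only [sigmaFactor, PowerSeries.coeff_mk]
    rw [coeff_monomial_mul, if_neg h']
  · intro h0
    simp at h0

/-- Every finite partial product of `∏ I, σ_{s t ^ I}(a_I)` that includes the factors with `I ≤ J`
has the same coefficients at `t ^ J`. -/
theorem coeff_prod_sigmaFactor (f : MvPowerSeries ℕ R) (k : ℕ) (J : ℕ →₀ ℕ)
    (S : Finset (ℕ →₀ ℕ)) (hS : Finset.Iic J ⊆ S) :
    coeff J (PowerSeries.coeff k (∏ I ∈ S, sigmaFactor f I)) = coeff J (sigmaFun k f) := by
  classical
  have key : ∀ T : Finset (ℕ →₀ ℕ), (∀ I ∈ T, ¬ I ≤ J) → ∀ P : PowerSeries (MvPowerSeries ℕ R),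
      coeff J (PowerSeries.coeff k ((∏ I ∈ T, sigmaFactor f I) * P)) =
        coeff J (PowerSeries.coeff k P) := by
    intro T
    induction T using Finset.induction_on with
    | empty => intro _ P; simp
    | insert I T hI ih =>
      intro hT P
      rw [Finset.prod_insert hI, mul_assoc,
        coeff_sigmaFactor_mul f (hT I (Finset.mem_insert_self _ _)),
        ih (fun I' hI' => hT I' (Finset.mem_insert_of_mem hI'))]
  rw [← Finset.prod_sdiff hS, key _ (fun I hI hle => (Finset.mem_sdiff.1 hI).2
    (Finset.mem_Iic.2 hle)), coeff_sigmaFun]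

theorem sigmaFun_zero (f : MvPowerSeries ℕ R) : sigmaFun 0 f = 1 := by
  ext J
  rw [coeff_sigmaFun, PowerSeries.coeff_zero_eq_constantCoeff_apply, map_prod,
    Finset.prod_eq_one]
  intro I _
  rw [← PowerSeries.coeff_zero_eq_constantCoeff_apply, coeff_zero_sigmaFactor]

theorem sigmaFun_one (f : MvPowerSeries ℕ R) : sigmaFun 1 f = f := by
  classical
  ext J
  have key : ∀ S : Finset (ℕ →₀ ℕ), PowerSeries.coeff 0 (∏ I ∈ S, sigmaFactor f I) = 1 ∧
      PowerSeries.coeff 1 (∏ I ∈ S, sigmaFactor f I) =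
        ∑ I ∈ S, MvPowerSeries.monomial I (coeff I f) := by
    intro S
    induction S using Finset.induction_on with
    | empty => simp [PowerSeries.coeff_one]
    | insert I S hI ih =>
      rw [Finset.prod_insert hI, Finset.sum_insert hI]
      constructor
      · rw [PowerSeries.coeff_mul]
        simp [coeff_zero_sigmaFactor, ih.1, -PowerSeries.coeff_zero_eq_constantCoeff]
      · rw [PowerSeries.coeff_mul, Finset.Nat.antidiagonal_succ]
        simp only [Finset.Nat.antidiagonal_zero, Finset.map_singleton, Finset.sum_cons,
          Finset.sum_singleton, Function.Embedding.prodMap, Function.Embedding.coeFn_mk,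
          Prod.map, Function.Embedding.refl_apply, Nat.succ_eq_add_one, zero_add]
        rw [coeff_zero_sigmaFactor, ih.1, ih.2]
        simp only [sigmaFactor, PowerSeries.coeff_mk, PreLambdaRing.σ_one, one_smul]
        ring
  rw [coeff_sigmaFun, (key _).2, map_sum, Finset.sum_eq_single J]
  · exact coeff_monomial_same _ _
  · intro I _ hI
    exact coeff_monomial_ne hI.symm _
  · intro h
    exact absurd (Finset.mem_Iic.2 le_rfl) h

theorem sigmaFactor_add (f g : MvPowerSeries ℕ R) (I : ℕ →₀ ℕ) :
    sigmaFactor (f + g) I = sigmaFactor f I * sigmaFactor g I := by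
  ext1 n
  rw [PowerSeries.coeff_mul]
  simp only [sigmaFactor, PowerSeries.coeff_mk, map_add, PreLambdaRing.σ_add, map_sum]
  refine Finset.sum_congr rfl fun ij hij => ?_
  rw [monomial_mul_monomial, ← add_smul, Finset.HasAntidiagonal.mem_antidiagonal.1 hij]

theorem sigmaFun_add (n : ℕ) (f g : MvPowerSeries ℕ R) :
    sigmaFun n (f + g) = ∑ ij ∈ Finset.HasAntidiagonal.antidiagonal n, sigmaFun ij.1 f * sigmaFun ij.2 g := by
  classical
  ext J
  simp only [coeff_sigmaFun n, sigmaFactor_add, Finset.prod_mul_distrib]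
  rw [PowerSeries.coeff_mul, map_sum, map_sum]
  refine Finset.sum_congr rfl fun ij _ => ?_
  rw [coeff_mul, coeff_mul]
  refine Finset.sum_congr rfl fun KL hKL => ?_
  have hKL := Finset.HasAntidiagonal.mem_antidiagonal.1 hKL
  rw [coeff_prod_sigmaFactor, coeff_prod_sigmaFactor]
  · exact Finset.Iic_subset_Iic.2 (hKL ▸ le_add_self)
  · exact Finset.Iic_subset_Iic.2 (hKL ▸ le_self_add)

theorem sigmaFun_mem (k : ℕ) {f : MvPowerSeries ℕ R} (hf : f ∈ SymPowerSeries R) :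
    sigmaFun k f ∈ SymPowerSeries R := by
  classical
  rw [mem_iff]
  intro e J
  have hfac : ∀ I : ℕ →₀ ℕ, sigmaFactor f (I.mapDomain e) =
      PowerSeries.map (rename e : MvPowerSeries ℕ R →ₐ[R] MvPowerSeries ℕ R).toRingHom
        (sigmaFactor f I) := by
    intro I
    ext1 c
    simp only [sigmaFactor, PowerSeries.coeff_mk, PowerSeries.coeff_map]
    change _ = rename e _
    rw [rename_monomial, Finsupp.mapDomain_smul, mem_iff.1 hf]
  have hinj : Function.Injective (Finsupp.mapDomain e : (ℕ →₀ ℕ) → (ℕ →₀ ℕ)) :=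
    Finsupp.mapDomain_injective e.injective
  have himg : Finset.Iic (J.mapDomain e) = (Finset.Iic J).image (Finsupp.mapDomain e) := by
    ext I
    simp only [Finset.mem_Iic, Finset.mem_image]
    constructor
    · intro h
      refine ⟨I.mapDomain e.symm, fun i => ?_, by rw [← Finsupp.mapDomain_comp]; simp⟩
      have := h (e i)
      rw [Finsupp.mapDomain_apply e.injective] at this
      rw [← Finsupp.equivMapDomain_eq_mapDomain]
      simpa [Finsupp.equivMapDomain_apply] using this
    · rintro ⟨I, h, rfl⟩ i
      rw [← Finsupp.equivMapDomain_eq_mapDomain, ← Finsupp.equivMapDomain_eq_mapDomain]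
      simpa [Finsupp.equivMapDomain_apply] using h (e.symm i)
  rw [coeff_sigmaFun, himg, Finset.prod_image fun _ _ _ _ h => hinj h,
    Finset.prod_congr rfl fun I _ => hfac I, ← map_prod, PowerSeries.coeff_map]
  exact coeff_mapDomain_rename e _ J

/-- The natural pre-`λ` structure on `Λ_R^∧`, for `R` a pre-`λ` ring: the one with
`σ k (r t ^ I) = σ k r * t ^ (k I)` for monomials, i.e.
`σ_s(∑ I, a_I t ^ I) = ∏ I, σ_{s t ^ I}(a_I)`. -/
noncomputable instance : PreLambdaRing (SymPowerSeries R) where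
  σ k f := ⟨sigmaFun k f, sigmaFun_mem k f.2⟩
  σ_zero f := Subtype.ext (sigmaFun_zero _)
  σ_one f := Subtype.ext (sigmaFun_one _)
  σ_add n f g := Subtype.ext (by
    simp only [AddSubmonoidClass.coe_finsetSum, MulMemClass.coe_mul]
    exact sigmaFun_add n (f : MvPowerSeries ℕ R) g)

end Sigma

/-! ### Elementary and complete symmetric functions, and power series in them -/

open Classical in
/-- The `k`-th elementary symmetric function `e_k`: the sum of all squarefree monomials of
degree `k`. -/
noncomputable def elem (R : Type*) [CommRing R] (k : ℕ) : SymPowerSeries R :=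
  ⟨fun J => if J.degree = k ∧ ∀ i, J i ≤ 1 then 1 else 0, mk_mem _ fun e J => by
    have h : (∀ i, (J.mapDomain e) i ≤ 1) ↔ ∀ i, J i ≤ 1 := by
      rw [← e.forall_congr_right]
      simp only [Finsupp.mapDomain_apply e.injective]
    simp only [Finsupp.degree_mapDomain, h]⟩

/-- The `k`-th complete symmetric function `h_k`: the sum of all monomials of degree `k`. -/
noncomputable def complete (R : Type*) [CommRing R] (k : ℕ) : SymPowerSeries R :=
  ⟨fun J => if J.degree = k then 1 else 0, mk_mem _ fun e J => by
    simp only [Finsupp.degree_mapDomain]⟩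

theorem isHomogeneous_of {f : MvPowerSeries ℕ R} {k : ℕ}
    (h : ∀ J : ℕ →₀ ℕ, J.degree ≠ k → coeff J f = 0) : f.IsHomogeneous k := by
  intro J hJ
  have h1 : Finsupp.weight (1 : ℕ → ℕ) J = J.degree :=
    (DFunLike.congr_fun Finsupp.degree_eq_weight_one J).symm
  rw [h1]
  by_contra hne
  exact hJ (h J hne)

theorem elem_isHomogeneous (k : ℕ) : (elem R k : MvPowerSeries ℕ R).IsHomogeneous k := by
  classical
  exact isHomogeneous_of fun J hJ => if_neg fun h => hJ h.1

theorem complete_isHomogeneous (k : ℕ) : (complete R k : MvPowerSeries ℕ R).IsHomogeneous k :=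
  isHomogeneous_of fun _ hJ => if_neg hJ

section Subst

variable {a : ℕ → SymPowerSeries R}

theorem hasSubst (ha : ∀ i, (a i : MvPowerSeries ℕ R).IsHomogeneous (i + 1)) :
    HasSubst fun i => (a i : MvPowerSeries ℕ R) where
  const_coeff i := by
    have : constantCoeff (a i : MvPowerSeries ℕ R) = 0 := by
      rw [← coeff_zero_eq_constantCoeff_apply]
      exact IsHomogeneous.coeff_eq_zero (ha i) (by simp)
    rw [this]
    exact IsNilpotent.zero
  coeff_zero J := by
    refine (Set.finite_le_nat J.degree).subset fun i hi => ?_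
    by_contra h
    simp only [Set.mem_ofPred_eq, not_le] at h
    exact hi (IsHomogeneous.coeff_eq_zero (ha i) (by omega))

theorem subst_mem (ha : ∀ i, (a i : MvPowerSeries ℕ R).IsHomogeneous (i + 1))
    (g : MvPowerSeries ℕ R) :
    substAlgHom (R := R) (hasSubst ha) g ∈ SymPowerSeries R := by
  rw [mem_iff]
  intro e J
  rw [substAlgHom_apply, coeff_subst (hasSubst ha), coeff_subst (hasSubst ha)]
  refine finsum_congr fun m => ?_
  rw [mem_iff.1 (show (m.prod fun i c => (a i : MvPowerSeries ℕ R) ^ c) ∈ SymPowerSeries R from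
    Subalgebra.prod_mem _ fun i _ => Subalgebra.pow_mem _ (a i).2 _) e J]

/-- The continuous `R`-algebra homomorphism `R⟦X_0, X_1, …⟧ → Λ_R^∧`, `X_i ↦ a_i`, for `a_i`
homogeneous of degree `i + 1`. -/
noncomputable def substHom (a : ℕ → SymPowerSeries R)
    (ha : ∀ i, (a i : MvPowerSeries ℕ R).IsHomogeneous (i + 1)) :
    MvPowerSeries ℕ R →ₐ[R] SymPowerSeries R :=
  (substAlgHom (hasSubst ha)).codRestrict (SymPowerSeries R) (subst_mem ha)

theorem substHom_X (ha : ∀ i, (a i : MvPowerSeries ℕ R).IsHomogeneous (i + 1)) (i : ℕ) :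
    substHom a ha (X i) = a i :=
  Subtype.ext (substAlgHom_X (hasSubst ha) i)

end Subst

/-- `X_i ↦ e_{i + 1}` -/
noncomputable def elemHom (R : Type*) [CommRing R] : MvPowerSeries ℕ R →ₐ[R] SymPowerSeries R :=
  substHom (fun i => elem R (i + 1)) fun i => elem_isHomogeneous (i + 1)

/-- `X_i ↦ h_{i + 1}` -/
noncomputable def completeHom (R : Type*) [CommRing R] :
    MvPowerSeries ℕ R →ₐ[R] SymPowerSeries R :=
  substHom (fun i => complete R (i + 1)) fun i => complete_isHomogeneous (i + 1)

section Bijective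

/-- the inclusion of the first `n` variables, on exponents -/
noncomputable def emb {n : ℕ} (m : Fin n →₀ ℕ) : ℕ →₀ ℕ := Finsupp.embDomain Fin.valEmbedding m

/-- the weight of an exponent of `X_0, X_1, …`, with `X_i` of weight `i + 1` -/
noncomputable def wt (m : ℕ →₀ ℕ) : ℕ := Finsupp.weight (fun i => i + 1) m

theorem degree_emb {n : ℕ} (m : Fin n →₀ ℕ) : (emb m).degree = m.degree := by
  rw [emb, Finsupp.embDomain_eq_mapDomain, Finsupp.degree_mapDomain]

theorem emb_injective {n : ℕ} : Function.Injective (emb (n := n)) :=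
  Finsupp.embDomain_injective _

theorem exists_emb_eq {n : ℕ} {m : ℕ →₀ ℕ} (h : ∀ i, m i ≠ 0 → i < n) :
    ∃ m' : Fin n →₀ ℕ, emb m' = m :=
  ⟨_, Finsupp.embDomain_comapDomain (f := Fin.valEmbedding) fun i hi =>
    ⟨⟨i, h i (Finsupp.mem_support_iff.1 hi)⟩, rfl⟩⟩

theorem exists_emb_of_wt (m : ℕ →₀ ℕ) : ∃ m' : Fin (wt m) →₀ ℕ, emb m' = m := by
  refine exists_emb_eq fun i hi => ?_
  rw [wt, Finsupp.weight_apply, Finsupp.sum]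
  have := Finset.single_le_sum (f := fun i => m i • (i + 1)) (fun _ _ => Nat.zero_le _)
    (Finsupp.mem_support_iff.2 hi)
  simp only [smul_eq_mul] at this ⊢
  have h2 := Nat.le_mul_of_pos_left (i + 1) (Nat.pos_of_ne_zero hi)
  omega

/-- the monomial in the `e_{i + 1}` with exponent `m` -/
noncomputable def elemMon (R : Type*) [CommRing R] (m : ℕ →₀ ℕ) : MvPowerSeries ℕ R :=
  m.prod fun i c => (elem R (i + 1) : MvPowerSeries ℕ R) ^ c

theorem coeff_elemMon {m J : ℕ →₀ ℕ} (h : J.degree ≠ wt m) : coeff J (elemMon R m) = 0 := by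
  classical
  have hone : (1 : MvPowerSeries ℕ R).IsHomogeneous 0 := by
    refine isHomogeneous_of fun J hJ => ?_
    rw [coeff_one, if_neg]
    rintro rfl
    simp at hJ
  have hpow : ∀ (i c : ℕ),
      ((elem R (i + 1) : MvPowerSeries ℕ R) ^ c).IsHomogeneous (c * (i + 1)) := by
    intro i c
    induction c with
    | zero => simp only [pow_zero, zero_mul]; exact hone
    | succ c ih => rw [pow_succ, add_mul, one_mul]; exact IsHomogeneous.mul ih (elem_isHomogeneous _)
  have hprod : ∀ s : Finset ℕ,
      (∏ i ∈ s, (elem R (i + 1) : MvPowerSeries ℕ R) ^ m i).IsHomogeneous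
        (∑ i ∈ s, m i * (i + 1)) := by
    intro s
    induction s using Finset.induction_on with
    | empty => simp only [Finset.prod_empty, Finset.sum_empty]; exact hone
    | insert i s hi ih =>
      rw [Finset.prod_insert hi, Finset.sum_insert hi]
      exact IsHomogeneous.mul (hpow _ _) ih
  exact IsHomogeneous.coeff_eq_zero (hprod m.support) h

theorem killCompl_elem (n k : ℕ) :
    killCompl (Fin.valEmbedding (n := n)) (elem R k : MvPowerSeries ℕ R) =
      (MvPolynomial.esymm (Fin n) R k : MvPowerSeries (Fin n) R) := by
  classical
  ext J
  rw [coeff_killCompl, MvPolynomial.coeff_coe, MvPolynomial.esymm_eq_sum_monomial,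
    MvPolynomial.coeff_sum]
  simp only [MvPolynomial.coeff_monomial]
  have hle : (∀ i, (emb J) i ≤ 1) ↔ ∀ i, J i ≤ 1 := by
    constructor
    · intro h i
      have := h (Fin.valEmbedding i)
      rwa [emb, Finsupp.embDomain_apply_self] at this
    · intro h i
      by_cases hi : i ∈ Set.range (Fin.valEmbedding (n := n))
      · obtain ⟨i, rfl⟩ := hi
        rw [emb, Finsupp.embDomain_apply_self]
        exact h i
      · rw [emb, Finsupp.embDomain_of_notMem_range _ _ _ hi]
        exact Nat.zero_le _
  have hdeg : ∀ t : Finset (Fin n), (∑ i ∈ t, Finsupp.single i 1 : Fin n →₀ ℕ).degree = t.card := by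
    intro t
    rw [map_sum]
    simp
  have happ : ∀ (t : Finset (Fin n)) (i : Fin n),
      (∑ i ∈ t, Finsupp.single i 1 : Fin n →₀ ℕ) i = if i ∈ t then 1 else 0 := by
    intro t i
    rw [Finsupp.finsetSum_apply]
    simp [Finsupp.single_apply]
  have hlhs : coeff (emb J) (elem R k : MvPowerSeries ℕ R) =
      if J.degree = k ∧ ∀ i, J i ≤ 1 then 1 else 0 := by
    have : coeff (emb J) (elem R k : MvPowerSeries ℕ R) =
        if (emb J).degree = k ∧ ∀ i, (emb J) i ≤ 1 then 1 else 0 := by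
      change ite _ _ _ = _
      congr
    simp only [this, degree_emb, hle]
  change coeff (emb J) (elem R k : MvPowerSeries ℕ R) = _
  rw [hlhs]
  split_ifs with h
  · have hJ : ∑ i ∈ J.support, Finsupp.single i 1 = J := by
      ext i
      rw [happ]
      have := h.2 i
      split_ifs with hi
      · have := Finsupp.mem_support_iff.1 hi
        omega
      · exact (Finsupp.notMem_support_iff.1 hi).symm
    rw [Finset.sum_eq_single J.support, if_pos hJ]
    · intro t _ ht
      refine if_neg fun hs => ht ?_
      ext i
      have := happ t i
      rw [hs] at this
      rw [Finsupp.mem_support_iff, this]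
      simp
    · intro hn
      refine absurd (Finset.mem_powersetCard_univ.2 ?_) hn
      rw [← hdeg, hJ, h.1]
  · refine (Finset.sum_eq_zero fun t ht => if_neg ?_).symm
    rintro rfl
    refine h ⟨by rw [hdeg]; exact Finset.mem_powersetCard_univ.1 ht, fun i => ?_⟩
    rw [happ]
    split_ifs <;> omega

theorem coeff_emb_elemMon {n : ℕ} (m J : Fin n →₀ ℕ) :
    coeff (emb J) (elemMon R (emb m)) =
      MvPolynomial.coeff J (MvPolynomial.esymmAlgHom (Fin n) R n
        (MvPolynomial.monomial m 1)).val := by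
  have h1 : coeff (emb J) (elemMon R (emb m)) =
      coeff J (killCompl (Fin.valEmbedding (n := n)) (elemMon R (emb m))) := rfl
  rw [h1, ← MvPolynomial.coeff_coe, MvPolynomial.esymmAlgHom_apply]
  congr 1
  rw [elemMon, emb, Finsupp.prod_embDomain, MvPolynomial.aeval_monomial, map_one, one_mul,
    Finsupp.prod, Finsupp.prod, map_prod, ← MvPolynomial.coeToMvPowerSeries.ringHom_apply,
    map_prod]
  refine Finset.prod_congr rfl fun i _ => ?_
  rw [map_pow, map_pow, MvPolynomial.coeToMvPowerSeries.ringHom_apply, ← killCompl_elem]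
  rfl

/-- the exponents in the first `n` variables of weight `n` -/
noncomputable def exps (n : ℕ) : Finset (Fin n →₀ ℕ) :=
  (Finsupp.finite_of_nat_weight_eq (fun i : Fin n => (i : ℕ) + 1) (fun _ => by simp) n).toFinset

theorem wt_emb {n : ℕ} (m : Fin n →₀ ℕ) :
    wt (emb m) = Finsupp.weight (fun i : Fin n => (i : ℕ) + 1) m := by
  rw [wt, Finsupp.weight_apply, Finsupp.weight_apply, emb, Finsupp.sum_embDomain]
  rfl

theorem mem_exps {n : ℕ} {m : Fin n →₀ ℕ} : m ∈ exps n ↔ wt (emb m) = n := by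
  rw [exps, Set.Finite.mem_toFinset, wt_emb]
  rfl

theorem coeff_elemHom {n : ℕ} (g : MvPowerSeries ℕ R) {J : ℕ →₀ ℕ} (hJ : J.degree = n) :
    coeff J (elemHom R g : MvPowerSeries ℕ R) =
      ∑ m ∈ exps n, coeff (emb m) g * coeff J (elemMon R (emb m)) := by
  classical
  have h : coeff J (elemHom R g : MvPowerSeries ℕ R) =
      finsum fun m => coeff m g • coeff J (elemMon R m) := by
    change coeff J (substAlgHom (R := R)
      (hasSubst fun i => elem_isHomogeneous (R := R) (i + 1)) g) = _
    rw [substAlgHom_apply, coeff_subst (hasSubst fun i => elem_isHomogeneous (i + 1))]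
    rfl
  rw [h, finsum_eq_sum_of_support_subset (s := (exps n).image emb),
    Finset.sum_image fun _ _ _ _ h => emb_injective h]
  · rfl
  · intro m hm
    have hw : wt m = n := by
      by_contra hne
      refine hm ?_
      change coeff m g • coeff J (elemMon R m) = 0
      rw [coeff_elemMon (by rw [hJ]; exact Ne.symm hne), smul_zero]
    subst hw
    obtain ⟨m', hm'⟩ := exists_emb_of_wt m
    exact Finset.mem_coe.2 (Finset.mem_image.2 ⟨m', mem_exps.2 (by rw [hm']), hm'⟩)

theorem coeff_esymmAlgHom_sum {n : ℕ} (s : Finset (Fin n →₀ ℕ)) (q : (Fin n →₀ ℕ) → R)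
    (J : Fin n →₀ ℕ) :
    MvPolynomial.coeff J (MvPolynomial.esymmAlgHom (Fin n) R n
        (∑ m ∈ s, MvPolynomial.monomial m (q m))).val =
      ∑ m ∈ s, q m * coeff (emb J) (elemMon R (emb m)) := by
  rw [map_sum, AddSubmonoidClass.coe_finsetSum, MvPolynomial.coeff_sum]
  refine Finset.sum_congr rfl fun m _ => ?_
  have : MvPolynomial.monomial m (q m) = q m • MvPolynomial.monomial m (1 : R) := by
    rw [MvPolynomial.smul_monomial, smul_eq_mul, mul_one]
  rw [this, map_smul, SetLike.val_smul, MvPolynomial.coeff_smul, coeff_emb_elemMon, smul_eq_mul]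

theorem elemHom_injective : Function.Injective (elemHom R) := by
  rw [injective_iff_map_eq_zero]
  intro g hg
  ext m
  obtain ⟨n, hn⟩ : ∃ n, n = wt m := ⟨_, rfl⟩
  obtain ⟨m', hm'⟩ : ∃ m' : Fin n →₀ ℕ, emb m' = m := hn ▸ exists_emb_of_wt m
  have hP : (∑ m ∈ exps n, MvPolynomial.monomial m (coeff (emb m) g)) = 0 := by
    apply MvPolynomial.esymmAlgHom_fin_injective R le_rfl
    rw [map_zero]
    apply Subtype.ext
    ext J
    rw [coeff_esymmAlgHom_sum]
    change _ = 0
    by_cases hJ : (emb J).degree = n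
    · rw [← coeff_elemHom g hJ, hg]
      rfl
    · refine Finset.sum_eq_zero fun k hk => ?_
      rw [coeff_elemMon (by rw [mem_exps.1 hk]; exact hJ), mul_zero]
  have := congrArg (MvPolynomial.coeff m') hP
  classical
  rw [MvPolynomial.coeff_sum] at this
  simp only [MvPolynomial.coeff_monomial, Finset.sum_ite_eq', MvPolynomial.coeff_zero] at this
  rw [if_pos (mem_exps.2 (by rw [hm', hn]))] at this
  rw [← hm', this]
  rfl

/-- every monomial of degree `n` becomes a monomial in the first `n` variables after a permutation
of the variables -/
theorem exists_perm_emb (J : ℕ →₀ ℕ) :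
    ∃ (e : Equiv.Perm ℕ) (J' : Fin J.degree →₀ ℕ), J.mapDomain e = emb J' := by
  have hc : J.support.card ≤ J.degree := by
    rw [Finsupp.degree_apply, Finset.card_eq_sum_ones]
    exact Finset.sum_le_sum fun i hi => Nat.pos_of_ne_zero (Finsupp.mem_support_iff.1 hi)
  obtain ⟨e, he⟩ := Equiv.Perm.exists_extending_pair
    (fun i : Fin J.support.card => ((J.support.equivFin.symm i : J.support) : ℕ))
    (fun i : Fin J.support.card => (i : ℕ))
    (Subtype.val_injective.comp J.support.equivFin.symm.injective) Fin.val_injective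
  refine ⟨e, ?_⟩
  have : ∀ i, (J.mapDomain e) i ≠ 0 → i < J.degree := by
    intro i hi
    obtain ⟨j, rfl⟩ := e.surjective i
    rw [Finsupp.mapDomain_apply e.injective] at hi
    have h := he (J.support.equivFin ⟨j, Finsupp.mem_support_iff.2 hi⟩)
    simp only [Equiv.symm_apply_apply] at h
    rw [h]
    exact lt_of_lt_of_le (Fin.is_lt _) hc
  obtain ⟨J', hJ'⟩ := exists_emb_eq this
  exact ⟨J', hJ'.symm⟩

theorem exists_symmetric (f : SymPowerSeries R) (n : ℕ) :
    ∃ F : MvPolynomial.symmetricSubalgebra (Fin n) R, ∀ J : Fin n →₀ ℕ, J.degree = n →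
      MvPolynomial.coeff J F.val = coeff (emb J) (f : MvPowerSeries ℕ R) := by
  classical
  let F : MvPolynomial (Fin n) R := ∑ J ∈ (Finsupp.finite_of_degree_eq (σ := Fin n) n).toFinset,
    MvPolynomial.monomial J (coeff (emb J) (f : MvPowerSeries ℕ R))
  have hF : ∀ J, MvPolynomial.coeff J F =
      if J.degree = n then coeff (emb J) (f : MvPowerSeries ℕ R) else 0 := by
    intro J
    simp only [F, MvPolynomial.coeff_sum, MvPolynomial.coeff_monomial, Finset.sum_ite_eq',
      Set.Finite.mem_toFinset, Set.mem_ofPred_eq]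
  refine ⟨⟨F, fun e => ?_⟩, fun J hJ => by rw [hF, if_pos hJ]⟩
  ext J
  obtain ⟨J, rfl⟩ : ∃ J' : Fin n →₀ ℕ, J'.mapDomain e = J :=
    ⟨J.mapDomain e.symm, by rw [← Finsupp.mapDomain_comp]; simp⟩
  have hemb : emb (J.mapDomain e) = (emb J).mapDomain (e.viaEmbedding Fin.valEmbedding) := by
    rw [emb, emb, Finsupp.embDomain_eq_mapDomain, Finsupp.embDomain_eq_mapDomain,
      ← Finsupp.mapDomain_comp, ← Finsupp.mapDomain_comp]
    congr 1
    funext i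
    exact (Equiv.Perm.viaEmbedding_apply e Fin.valEmbedding i).symm
  rw [MvPolynomial.coeff_rename_mapDomain _ e.injective, hF, hF, Finsupp.degree_mapDomain, hemb,
    mem_iff.1 f.2]

theorem elemHom_surjective : Function.Surjective (elemHom R) := by
  classical
  intro f
  choose F hF using exists_symmetric f
  choose Q hQ using fun n => (MvPolynomial.esymmAlgHom_fin_bijective R n).2 (F n)
  let q : ℕ → (ℕ →₀ ℕ) → R := fun n m =>
    MvPolynomial.coeff (Finsupp.comapDomain Fin.val m Fin.val_injective.injOn) (Q n)
  have hq : ∀ (n : ℕ) (m : Fin n →₀ ℕ), q n (emb m) = MvPolynomial.coeff m (Q n) := fun n m =>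
    congrArg (fun k => MvPolynomial.coeff k (Q n))
      (Finsupp.comapDomain_embDomain Fin.valEmbedding m)
  let g : MvPowerSeries ℕ R := fun m => q (wt m) m
  refine ⟨g, Subtype.ext ?_⟩
  ext J
  obtain ⟨e, J', hJ'⟩ := exists_perm_emb J
  have hdeg : J'.degree = J.degree := by
    rw [← degree_emb, ← hJ', Finsupp.degree_mapDomain]
  rw [← mem_iff.1 f.2 e J, ← mem_iff.1 (elemHom R g).2 e J, hJ', ← hF _ J' hdeg, ← hQ,
    coeff_elemHom g ((degree_emb J').trans hdeg)]
  have hg : ∀ m ∈ exps J.degree, coeff (emb m) g * coeff (emb J') (elemMon R (emb m)) =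
      MvPolynomial.coeff m (Q J.degree) * coeff (emb J') (elemMon R (emb m)) := by
    intro m hm
    have : coeff (emb m) g = q (wt (emb m)) (emb m) := rfl
    rw [this, mem_exps.1 hm, hq]
  rw [Finset.sum_congr rfl hg]
  conv_rhs => rw [MvPolynomial.as_sum (Q J.degree), coeff_esymmAlgHom_sum]
  rw [Finset.sum_subset Finset.subset_union_left
    (s₂ := exps J.degree ∪ (Q J.degree).support),
    Finset.sum_subset (s₁ := (Q J.degree).support) Finset.subset_union_right
    (s₂ := exps J.degree ∪ (Q J.degree).support)]
  · intro m _ hm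
    rw [MvPolynomial.notMem_support_iff.1 hm, zero_mul]
  · intro m _ hm
    rw [coeff_elemMon, mul_zero]
    rw [degree_emb, hdeg]
    exact fun h => hm (mem_exps.2 h.symm)

end Bijective

/-- `Λ_R^∧` is the ring of formal power series in `e_1, e_2, …`. -/
noncomputable def elemEquiv (R : Type*) [CommRing R] : MvPowerSeries ℕ R ≃ₐ[R] SymPowerSeries R :=
  AlgEquiv.ofBijective (elemHom R) ⟨elemHom_injective, elemHom_surjective⟩

/-! ### The involution -/

/-- The involution `ω` of `Λ_R^∧`: the continuous `R`-algebra homomorphism with `e_i ↦ h_i`. -/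
noncomputable def omega (R : Type*) [CommRing R] : SymPowerSeries R →ₐ[R] SymPowerSeries R :=
  (completeHom R).comp (elemEquiv R).symm.toAlgHom

theorem omega_elem (i : ℕ) : omega R (elem R (i + 1)) = complete R (i + 1) := by
  have h : (elemEquiv R).symm (elem R (i + 1)) = X i := by
    rw [AlgEquiv.symm_apply_eq]
    exact (substHom_X (fun i => elem_isHomogeneous (i + 1)) i).symm
  change completeHom R ((elemEquiv R).symm (elem R (i + 1))) = _
  rw [h]
  exact substHom_X (fun i => complete_isHomogeneous (i + 1)) i

/-- multiplication by `(-1) ^ i` on the component of degree `i` -/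
noncomputable def flipFun (f : MvPowerSeries ℕ R) : MvPowerSeries ℕ R :=
  fun J => (-1) ^ J.degree * coeff J f

theorem coeff_flipFun (f : MvPowerSeries ℕ R) (J : ℕ →₀ ℕ) :
    coeff J (flipFun f) = (-1) ^ J.degree * coeff J f := rfl

/-- The degree flip involution of `Λ_R^∧`: multiplication by `(-1) ^ i` on the component of
degree `i`. -/
noncomputable def degreeFlip (R : Type*) [CommRing R] :
    SymPowerSeries R →ₐ[R] SymPowerSeries R where
  toFun f := ⟨flipFun f, mem_iff.2 fun e J => by
    rw [coeff_flipFun, coeff_flipFun, Finsupp.degree_mapDomain, mem_iff.1 f.2 e J]⟩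
  map_zero' := by
    apply Subtype.ext
    ext J
    exact mul_zero _
  map_one' := by
    classical
    apply Subtype.ext
    ext J
    change coeff J (flipFun 1) = coeff J (1 : MvPowerSeries ℕ R)
    rw [coeff_flipFun, coeff_one]
    split_ifs with h
    · simp [h]
    · simp
  map_add' f g := by
    apply Subtype.ext
    ext J
    exact mul_add _ _ _
  map_mul' f g := by
    classical
    apply Subtype.ext
    ext J
    change coeff J (flipFun (f.1 * g.1)) = coeff J (flipFun f.1 * flipFun g.1)
    rw [coeff_flipFun, coeff_mul, coeff_mul, Finset.mul_sum]
    refine Finset.sum_congr rfl fun KL h => ?_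
    rw [← Finset.HasAntidiagonal.mem_antidiagonal.1 h, map_add, pow_add, coeff_flipFun,
      coeff_flipFun]
    ring
  commutes' r := by
    classical
    apply Subtype.ext
    ext J
    change coeff J (flipFun (C r)) = coeff J (C r : MvPowerSeries ℕ R)
    rw [coeff_flipFun, coeff_C]
    split_ifs with h
    · simp [h]
    · simp

/-- The involution `ω̃` of `Λ_R^∧`: the composition of `ω` with the degree flip, so that
`ω̃ e_i = (-1) ^ i h_i`. -/
noncomputable def omegaTilde (R : Type*) [CommRing R] :
    SymPowerSeries R →ₐ[R] SymPowerSeries R :=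
  (degreeFlip R).comp (omega R)

/-! ### The degree filtration and the `σ`-exponential -/

/-- The degree filtration: `Fil^n Λ_R^∧` consists of the symmetric power series all of whose
monomials have degree at least `n`. -/
def fil (R : Type*) [CommRing R] (n : ℕ) : Ideal (SymPowerSeries R) where
  carrier := {f | ∀ J : ℕ →₀ ℕ, J.degree < n → coeff J (f : MvPowerSeries ℕ R) = 0}
  zero_mem' _ _ := rfl
  add_mem' ha hb J hJ := by
    rw [Subalgebra.coe_add, map_add, ha J hJ, hb J hJ, add_zero]
  smul_mem' c f hf J hJ := by
    classical
    change coeff J ((c : MvPowerSeries ℕ R) * (f : MvPowerSeries ℕ R)) = 0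
    rw [coeff_mul]
    refine Finset.sum_eq_zero fun KL h => ?_
    have h := congrArg Finsupp.degree (Finset.HasAntidiagonal.mem_antidiagonal.1 h)
    rw [map_add] at h
    rw [hf KL.2 (by omega), mul_zero]

section Exp

variable [PreLambdaRing R]

/-- For `f` in `Fil^1`, the series `σ k f` only has monomials of degree at least `k`. -/
theorem sigma_mem_fil {f : SymPowerSeries R} (hf : f ∈ fil R 1) (k : ℕ) :
    PreLambdaRing.σ k f ∈ fil R k := by
  classical
  intro J hJ
  change coeff J (sigmaFun k (f : MvPowerSeries ℕ R)) = 0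
  rw [coeff_sigmaFun, PowerSeries.coeff_prod, map_sum]
  refine Finset.sum_eq_zero fun l hl => ?_
  obtain ⟨hl, hls⟩ := Finset.mem_finsuppAntidiag.1 hl
  have h0 : coeff 0 (f : MvPowerSeries ℕ R) = 0 := hf 0 (by simp)
  by_cases hl0 : l 0 = 0
  · have hprod : ∀ s : Finset (ℕ →₀ ℕ),
        ∃ r : R, ∏ I ∈ s, PowerSeries.coeff (l I) (sigmaFactor (f : MvPowerSeries ℕ R) I) =
          MvPowerSeries.monomial (∑ I ∈ s, l I • I) r := by
      intro s
      induction s using Finset.induction_on with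
      | empty => exact ⟨1, rfl⟩
      | insert I s hI ih =>
        obtain ⟨r, hr⟩ := ih
        rw [Finset.prod_insert hI, Finset.sum_insert hI, hr, sigmaFactor, PowerSeries.coeff_mk,
          monomial_mul_monomial]
        exact ⟨_, rfl⟩
    obtain ⟨r, hr⟩ := hprod (Finset.Iic J)
    rw [hr, coeff_monomial_ne]
    intro hJ'
    refine absurd hJ (not_lt.2 ?_)
    rw [hJ', ← hl, map_sum]
    refine Finset.sum_le_sum fun I _ => ?_
    rw [map_nsmul, smul_eq_mul]
    by_cases hI : I = 0
    · simp [hI, hl0]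
    · exact Nat.le_mul_of_pos_right _ (Nat.pos_of_ne_zero fun h =>
        hI ((Finsupp.degree_eq_zero_iff I).1 h))
  · rw [Finset.prod_eq_zero (i := (0 : ℕ →₀ ℕ)), map_zero]
    · exact Finset.mem_Iic.2 (fun _ => Nat.zero_le _)
    · rw [sigmaFactor, PowerSeries.coeff_mk, h0, sigma_zero_right _ hl0, map_zero]

/-- The `σ`-exponential `Exp_σ f = ∑ k, σ k f` of `f` in `Fil^1`. The coefficient at `t ^ J` of this
infinite sum only involves the terms with `k ≤ deg J`, by `sigma_mem_fil`. -/
noncomputable def Exp (f : SymPowerSeries R) : SymPowerSeries R :=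
  ⟨fun J => ∑ k ∈ Finset.range (J.degree + 1),
      coeff J ((PreLambdaRing.σ k f : SymPowerSeries R) : MvPowerSeries ℕ R), mk_mem _ fun e J => by
    simp only [Finsupp.degree_mapDomain]
    exact Finset.sum_congr rfl fun k _ => mem_iff.1 (PreLambdaRing.σ k f).2 e J⟩

end Exp

end SymPowerSeries

/-! When division by nonzero integers is unambiguous, the `σ`-operations are determined by the
logarithmic derivative of `σ_t`, whose coefficients are the Adams operations `ψ_{n+1}`: `(n+1)
σ_{n+1} = ∑ σ_i ψ_{j+1}` over `i + j = n`. Since `Λ_R^∧` inherits torsion-freeness from `R`, it is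
enough that `ω̃` commutes with the Adams operations of `Λ_R^∧`. Applied to the product `∏ σ_{s
t^I}(a_I)`, the logarithmic derivative gives `ψ_{n+1}(∑ a_I t^I) = ∑ ψ_{n+1}(a_I) t^{(n+1)I}`
(`derivative_mk_sigmaFun`), so `ψ_{n+1}` is a coefficientwise additive map followed by the
`R`-algebra map `t_i ↦ t_i^{n+1}`. The two factors are treated separately.

The Adams operations of a mere pre-`λ` ring are only additive. This suffices, because monomials in
the `e_i` and in the `h_i` have integer coefficients, and additive maps commute with integers
(`omegaTilde_gradedMap`). Letting the additive map depend on the degree costs nothing and also shows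
that `ω̃` preserves the degree filtration.

For `t_i ↦ t_i^{n+1}`, both composites with `ω̃` are filtered `R`-algebra endomorphisms, hence
determined by the images of the `e_i` (`algHom_ext`), and by Newton's identities and
torsion-freeness by those of the power sums. There `ω̃ p_k = -p_k`, while `p_k ↦ p_{(n+1)k}` under
the substitution, so the two maps commute (`omegaTilde_comp_frobenius`).

The statement on `Exp_σ` follows by letting the partial sums converge in the degree filtration. -/

namespace PreLambdaRing

/-! ### Logarithmic derivative of `σ_t` and Adams operations -/

variable {A : Type*} [CommRing A]

/-- Two power series with constant term `1` and the same logarithmic derivative agree. -/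
theorem eq_of_derivative_eq_mul [IsAddTorsionFree A] {S T P : PowerSeries A}
    (hS0 : PowerSeries.coeff 0 S = 1) (hT0 : PowerSeries.coeff 0 T = 1)
    (hS : PowerSeries.derivative A S = S * P) (hT : PowerSeries.derivative A T = T * P) :
    S = T := by
  ext n
  induction n using Nat.strong_induction_on with
  | _ n ih =>
    cases n with
    | zero => rw [hS0, hT0]
    | succ n =>
      have h : PowerSeries.coeff n (S * P) = PowerSeries.coeff n (T * P) := by
        rw [PowerSeries.coeff_mul, PowerSeries.coeff_mul]
        refine Finset.sum_congr rfl fun ij hij => ?_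
        have := Finset.HasAntidiagonal.mem_antidiagonal.1 hij
        rw [ih ij.1 (by omega)]
      rw [← hS, ← hT, PowerSeries.coeff_derivative, PowerSeries.coeff_derivative] at h
      -- Differentiation multiplied the coefficient of degree `n + 1` by `n + 1`; torsion-freeness
      -- cancels this factor.
      refine nsmul_right_injective (Nat.succ_ne_zero n) ?_
      simp only [nsmul_eq_mul, Nat.cast_succ]
      rw [mul_comm, h, mul_comm]

variable [PreLambdaRing A]

theorem σ_zero_right {n : ℕ} (hn : n ≠ 0) : σ n (0 : A) = 0 :=
  SymPowerSeries.sigma_zero_right n hn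

/-- The series `σ_t(a) = ∑ k, σ k a * t ^ k`. -/
noncomputable def sigmaSeries (a : A) : PowerSeries A := PowerSeries.mk fun k => σ k a

theorem coeff_sigmaSeries (k : ℕ) (a : A) : PowerSeries.coeff k (sigmaSeries a) = σ k a :=
  PowerSeries.coeff_mk _ _

theorem sigmaSeries_zero : sigmaSeries (0 : A) = 1 := by
  ext n
  rw [coeff_sigmaSeries, PowerSeries.coeff_one]
  split_ifs with h
  · rw [h, σ_zero]
  · exact σ_zero_right h

theorem sigmaSeries_add (a b : A) : sigmaSeries (a + b) = sigmaSeries a * sigmaSeries b := by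
  ext n
  rw [PowerSeries.coeff_mul, coeff_sigmaSeries, σ_add]
  simp only [coeff_sigmaSeries]

theorem sigmaSeries_mul_neg (a : A) : sigmaSeries a * sigmaSeries (-a) = 1 := by
  rw [← sigmaSeries_add, add_neg_cancel, sigmaSeries_zero]

/-- The logarithmic derivative of `σ_t(a)`, additive in `a`. -/
noncomputable def logDeriv : A →+ PowerSeries A where
  toFun a := sigmaSeries (-a) * PowerSeries.derivative A (sigmaSeries a)
  map_zero' := by simp [sigmaSeries_zero]
  map_add' a b := by
    have ha := sigmaSeries_mul_neg a
    have hb := sigmaSeries_mul_neg b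
    rw [neg_add, sigmaSeries_add, sigmaSeries_add, Derivation.leibniz, smul_eq_mul, smul_eq_mul]
    linear_combination
      (sigmaSeries (-a) * PowerSeries.derivative A (sigmaSeries a)) * hb +
        (sigmaSeries (-b) * PowerSeries.derivative A (sigmaSeries b)) * ha

theorem derivative_sigmaSeries (a : A) :
    PowerSeries.derivative A (sigmaSeries a) = sigmaSeries a * logDeriv a := by
  have ha := sigmaSeries_mul_neg a
  change _ = sigmaSeries a * (sigmaSeries (-a) * PowerSeries.derivative A (sigmaSeries a))
  rw [← mul_assoc, ha, one_mul]

/-- The Adams operation `ψ_{n + 1}`: the coefficient at `t ^ n` of the logarithmic derivative of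
`σ_t`. -/
noncomputable def adams (A : Type*) [CommRing A] [PreLambdaRing A] (n : ℕ) : A →+ A :=
  (PowerSeries.coeff n).toAddMonoidHom.comp logDeriv

theorem adams_apply (n : ℕ) (a : A) : adams A n a = PowerSeries.coeff n (logDeriv a) := rfl

/-- Coefficient form of `σ_t' = σ_t · ∑ ψ_{n+1} t^n`, the analogue of Newton's identity for the
`h_n`. -/
theorem σ_succ_mul (n : ℕ) (a : A) :
    σ (n + 1) a * (n + 1) =
      ∑ ij ∈ Finset.HasAntidiagonal.antidiagonal n, σ ij.1 a * adams A ij.2 a := by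
  have h := congrArg (PowerSeries.coeff n) (derivative_sigmaSeries a)
  rw [PowerSeries.coeff_derivative, coeff_sigmaSeries, PowerSeries.coeff_mul] at h
  simpa only [coeff_sigmaSeries, adams_apply] using h

end PreLambdaRing

namespace SymPowerSeries

variable {R : Type*} [CommRing R]

/-! ### The substitution `t_i ↦ t_i^{n+1}` -/

section Frobenius

variable (n : ℕ)

/-- The `R`-algebra endomorphism `t ^ I ↦ t ^ ((n + 1) I)` of `Λ_R^∧`. -/
noncomputable def frobenius (R : Type*) [CommRing R] (n : ℕ) :
    SymPowerSeries R →ₐ[R] SymPowerSeries R :=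
  ((expand (n + 1) n.succ_ne_zero).comp (SymPowerSeries R).val).codRestrict (SymPowerSeries R)
    fun f => by
      have key : ∀ (e : Equiv.Perm ℕ) (J : ℕ →₀ ℕ) (i : ℕ), J.mapDomain e (e i) = J i :=
        fun e J i => Finsupp.mapDomain_apply e.injective J i
      rw [mem_iff]
      intro e J
      change coeff _ (expand (n + 1) n.succ_ne_zero (f : MvPowerSeries ℕ R)) =
        coeff _ (expand (n + 1) n.succ_ne_zero (f : MvPowerSeries ℕ R))
      by_cases h : ∀ i, n + 1 ∣ J i
      · obtain ⟨I, rfl⟩ : ∃ I, (n + 1) • I = J :=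
          ⟨J.mapRange (· / (n + 1)) (Nat.zero_div _), by
            ext i
            simpa using Nat.mul_div_cancel' (h i)⟩
        rw [Finsupp.mapDomain_smul, coeff_expand_smul, coeff_expand_smul, mem_iff.1 f.2]
      · push Not at h
        obtain ⟨i, hi⟩ := h
        rw [coeff_expand_of_not_dvd _ _ _ hi, coeff_expand_of_not_dvd (i := e i)]
        rwa [key]

theorem coe_frobenius (f : SymPowerSeries R) :
    (frobenius R n f : MvPowerSeries ℕ R) = expand (n + 1) n.succ_ne_zero (f : MvPowerSeries ℕ R) :=
  rfl

end Frobenius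

/-- If `(n+1) I = J` then `I ≤ J`, so only finitely many `I` matter. This finite form matches the
finite products that define `sigmaFun`. -/
theorem coeff_expand_eq_sum (n : ℕ) (f : MvPowerSeries ℕ R) (J : ℕ →₀ ℕ) (S : Finset (ℕ →₀ ℕ))
    (hS : Finset.Iic J ⊆ S) :
    coeff J (expand (n + 1) n.succ_ne_zero f) =
      coeff J (∑ I ∈ S, monomial ((n + 1) • I) (coeff I f)) := by
  classical
  rw [map_sum]
  simp only [coeff_monomial]
  by_cases h : ∃ I, (n + 1) • I = J
  · obtain ⟨I, rfl⟩ := h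
    rw [coeff_expand_smul, Finset.sum_eq_single I, if_pos rfl]
    · intro I' _ hI'
      refine if_neg fun h => hI' ?_
      exact (nsmul_right_injective n.succ_ne_zero h).symm
    · intro hI
      refine absurd (hS (Finset.mem_Iic.2 fun i => ?_)) hI
      simpa using Nat.le_mul_of_pos_left (I i) n.succ_pos
  · rw [Finset.sum_eq_zero fun I _ => if_neg fun hI => h ⟨I, hI.symm⟩]
    have : ∃ i, ¬ n + 1 ∣ J i := by
      by_contra! hd
      exact h ⟨J.mapRange (· / (n + 1)) (Nat.zero_div _), by
        ext i
        simpa using Nat.mul_div_cancel' (hd i)⟩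
    obtain ⟨i, hi⟩ := this
    exact coeff_expand_of_not_dvd _ _ _ hi

/-! ### Logarithmic derivative of the infinite product `σ_s(f)` -/

section LogDeriv

variable [PreLambdaRing R]

/-- The operation `∑ I, a_I t ^ I ↦ ∑ I, ψ_{n + 1}(a_I) t ^ ((n + 1) I)`. -/
noncomputable def adamsFun (n : ℕ) (f : MvPowerSeries ℕ R) : MvPowerSeries ℕ R :=
  expand (n + 1) n.succ_ne_zero
    (show MvPowerSeries ℕ R from fun I => PreLambdaRing.adams R n (coeff I f))

/-- This is the recursion in `R` for `a_I` with `s` rescaled by `t^I`: the exponents `i I` and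
`(j+1) I` add up to `(n+1) I` whenever `i + j = n`. -/
theorem derivative_sigmaFactor (f : MvPowerSeries ℕ R) (I : ℕ →₀ ℕ) :
    PowerSeries.derivative _ (sigmaFactor f I) = sigmaFactor f I * PowerSeries.mk fun n =>
      monomial ((n + 1) • I) (PreLambdaRing.adams R n (coeff I f)) := by
  ext1 n
  rw [PowerSeries.coeff_derivative, PowerSeries.coeff_mul]
  simp only [sigmaFactor, PowerSeries.coeff_mk, monomial_mul_monomial]
  have h : ((n : MvPowerSeries ℕ R) + 1) = monomial 0 ((n : R) + 1) := by
    rw [monomial_zero_eq_C_apply, map_add, map_natCast, map_one]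
  rw [h, monomial_mul_monomial, add_zero, PreLambdaRing.σ_succ_mul, map_sum]
  refine Finset.sum_congr rfl fun ij hij => ?_
  rw [← add_smul, ← add_assoc, Finset.HasAntidiagonal.mem_antidiagonal.1 hij]

theorem derivative_prod_sigmaFactor (f : MvPowerSeries ℕ R) (S : Finset (ℕ →₀ ℕ)) :
    PowerSeries.derivative _ (∏ I ∈ S, sigmaFactor f I) =
      (∏ I ∈ S, sigmaFactor f I) * PowerSeries.mk fun n =>
        ∑ I ∈ S, monomial ((n + 1) • I) (PreLambdaRing.adams R n (coeff I f)) := by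
  classical
  induction S using Finset.induction_on with
  | empty =>
    rw [Finset.prod_empty, one_mul, Derivation.map_one_eq_zero]
    ext1 n
    simp
  | insert I S hI ih =>
    have h : (PowerSeries.mk fun n => ∑ I ∈ insert I S,
        monomial ((n + 1) • I) (PreLambdaRing.adams R n (coeff I f))) =
        (PowerSeries.mk fun n =>
          monomial ((n + 1) • I) (PreLambdaRing.adams R n (coeff I f))) +
        PowerSeries.mk fun n => ∑ I ∈ S,
          monomial ((n + 1) • I) (PreLambdaRing.adams R n (coeff I f)) := by
      ext1 n
      rw [map_add, PowerSeries.coeff_mk, PowerSeries.coeff_mk, PowerSeries.coeff_mk,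
        Finset.sum_insert hI]
    rw [h, Finset.prod_insert hI, Derivation.leibniz, ih, derivative_sigmaFactor, smul_eq_mul,
      smul_eq_mul]
    ring

/-- At `t^J`, both sides see only the factors with `I ≤ J`, so the infinite product may be replaced
by the finite one over `Iic J`; in the product of two series, the exponents `K + L = J` both lie
below `J`. -/
theorem derivative_mk_sigmaFun (f : MvPowerSeries ℕ R) :
    PowerSeries.derivative _ (PowerSeries.mk fun k => sigmaFun k f) =
      (PowerSeries.mk fun k => sigmaFun k f) * PowerSeries.mk fun n => adamsFun n f := by
  classical
  ext n J
  have h := congrArg (fun P => coeff J (PowerSeries.coeff n P))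
    (derivative_prod_sigmaFactor f (Finset.Iic J))
  simp only [PowerSeries.coeff_derivative, PowerSeries.coeff_mul, PowerSeries.coeff_mk] at h ⊢
  have hcast : ((n : MvPowerSeries ℕ R) + 1) = C ((n : R) + 1) := by
    rw [map_add, map_natCast, map_one]
  rw [hcast, coeff_mul_C] at h ⊢
  rw [coeff_sigmaFun, h, map_sum, map_sum]
  refine Finset.sum_congr rfl fun ij _ => ?_
  rw [coeff_mul, coeff_mul]
  refine Finset.sum_congr rfl fun KL hKL => ?_
  have hKL := Finset.HasAntidiagonal.mem_antidiagonal.1 hKL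
  rw [coeff_prod_sigmaFactor _ _ _ _ (Finset.Iic_subset_Iic.2 (hKL ▸ le_self_add)), adamsFun,
    coeff_expand_eq_sum _ _ _ _ (Finset.Iic_subset_Iic.2 (hKL ▸ le_add_self))]
  rfl

end LogDeriv

end SymPowerSeries

namespace SymPowerSeries

variable {R : Type*} [CommRing R]

/-! ### Coefficientwise additive maps and their compatibility with `ω̃` -/

section GradedMap

/-- The map acting on the coefficients of the component of degree `k` by `θ k`. -/
noncomputable def gradedMap (θ : ℕ → R →+ R) (f : SymPowerSeries R) : SymPowerSeries R :=
  ⟨fun J => θ J.degree (coeff J (f : MvPowerSeries ℕ R)), mk_mem _ fun e J => by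
    rw [Finsupp.degree_mapDomain, mem_iff.1 f.2]⟩

theorem coeff_gradedMap (θ : ℕ → R →+ R) (f : SymPowerSeries R) (J : ℕ →₀ ℕ) :
    coeff J (gradedMap θ f : MvPowerSeries ℕ R) =
      θ J.degree (coeff J (f : MvPowerSeries ℕ R)) := rfl

/-- The map acting on the coefficients of the monomials of weight `k` by `θ k`, where `X_i` has
weight `i + 1`. -/
noncomputable def weightedMap (θ : ℕ → R →+ R) (g : MvPowerSeries ℕ R) : MvPowerSeries ℕ R :=
  fun m => θ (wt m) (coeff m g)

theorem coeff_weightedMap (θ : ℕ → R →+ R) (g : MvPowerSeries ℕ R) (m : ℕ →₀ ℕ) :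
    coeff m (weightedMap θ g) = θ (wt m) (coeff m g) := rfl

theorem prod_pow_isHomogeneous {a : ℕ → MvPowerSeries ℕ R}
    (ha : ∀ i, (a i).IsHomogeneous (i + 1)) (m : ℕ →₀ ℕ) :
    (m.prod fun i c => a i ^ c).IsHomogeneous (wt m) := by
  classical
  have hone : (1 : MvPowerSeries ℕ R).IsHomogeneous 0 := by
    refine isHomogeneous_of fun J hJ => ?_
    rw [coeff_one, if_neg]
    rintro rfl
    simp at hJ
  have hpow : ∀ i c : ℕ, (a i ^ c).IsHomogeneous (c * (i + 1)) := by
    intro i c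
    induction c with
    | zero => simp only [pow_zero, zero_mul]; exact @hone
    | succ c ih => rw [pow_succ, add_mul, one_mul]; exact IsHomogeneous.mul ih (ha i)
  have hprod : ∀ s : Finset ℕ,
      (∏ i ∈ s, a i ^ m i).IsHomogeneous (∑ i ∈ s, m i * (i + 1)) := by
    intro s
    induction s using Finset.induction_on with
    | empty => simp only [Finset.prod_empty, Finset.sum_empty]; exact @hone
    | insert i s hi ih =>
      rw [Finset.prod_insert hi, Finset.sum_insert hi]
      exact IsHomogeneous.mul (hpow _ _) ih
  intro J hJ
  exact hprod m.support hJ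

/-- Integrality of the `a i` is the point: `θ k` is only additive, but it commutes with
multiplication by the integer coefficients of a monomial in the `a i`. Homogeneity matches the
weight of that monomial with the degree in the `t_i`. -/
theorem substHom_weightedMap {a : ℕ → SymPowerSeries R}
    (ha : ∀ i, (a i : MvPowerSeries ℕ R).IsHomogeneous (i + 1))
    (hint : ∀ i, (a i : MvPowerSeries ℕ R) ∈ (MvPowerSeries.map (Int.castRingHom R)).range)
    (θ : ℕ → R →+ R) (g : MvPowerSeries ℕ R) :
    substHom a ha (weightedMap θ g) = gradedMap θ (substHom a ha g) := by
  apply Subtype.ext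
  ext J
  rw [coeff_gradedMap]
  change coeff J (substAlgHom (R := R) (hasSubst ha) _) =
    θ _ (coeff J (substAlgHom (R := R) (hasSubst ha) _))
  rw [substAlgHom_apply, substAlgHom_apply, coeff_subst (hasSubst ha), coeff_subst (hasSubst ha),
    AddMonoidHom.map_finsum _ (coeff_subst_finite (hasSubst ha) g J)]
  refine finsum_congr fun m => ?_
  rw [coeff_weightedMap]
  -- When weight and degree agree, the same `θ` acts on both sides; otherwise the monomial in the `a
  -- i` has no `t^J` term.
  by_cases h : wt m = J.degree
  · obtain ⟨F, hF⟩ : (m.prod fun i c => (a i : MvPowerSeries ℕ R) ^ c) ∈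
        (MvPowerSeries.map (σ := ℕ) (Int.castRingHom R)).range :=
      Subring.prod_mem _ fun i _ => Subring.pow_mem _ (hint i) _
    rw [← hF, coeff_map, h, smul_eq_mul, smul_eq_mul, mul_comm, mul_comm (coeff m g),
      eq_intCast, ← zsmul_eq_mul, ← zsmul_eq_mul, map_zsmul]
  · have h0 : coeff J (m.prod fun i c => (a i : MvPowerSeries ℕ R) ^ c) = 0 :=
      IsHomogeneous.coeff_eq_zero (prod_pow_isHomogeneous ha m) (Ne.symm h)
    rw [h0, smul_zero, smul_zero, map_zero]

theorem elem_mem_range (k : ℕ) :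
    (elem R k : MvPowerSeries ℕ R) ∈ (MvPowerSeries.map (Int.castRingHom R)).range := by
  classical
  refine ⟨(elem ℤ k : MvPowerSeries ℕ ℤ), ?_⟩
  ext J
  rw [coeff_map]
  change Int.castRingHom R (ite _ _ _) = ite _ _ _
  split_ifs <;> simp

theorem complete_mem_range (k : ℕ) :
    (complete R k : MvPowerSeries ℕ R) ∈ (MvPowerSeries.map (Int.castRingHom R)).range := by
  refine ⟨(complete ℤ k : MvPowerSeries ℕ ℤ), ?_⟩
  ext J
  rw [coeff_map]
  change Int.castRingHom R (ite _ _ _) = ite _ _ _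
  split_ifs <;> simp

theorem omega_elemHom (g : MvPowerSeries ℕ R) : omega R (elemHom R g) = completeHom R g :=
  congrArg (completeHom R) ((elemEquiv R).symm_apply_apply g)

theorem elemHom_weightedMap (θ : ℕ → R →+ R) (g : MvPowerSeries ℕ R) :
    elemHom R (weightedMap θ g) = gradedMap θ (elemHom R g) :=
  substHom_weightedMap _ (fun i => elem_mem_range (i + 1)) θ g

theorem completeHom_weightedMap (θ : ℕ → R →+ R) (g : MvPowerSeries ℕ R) :
    completeHom R (weightedMap θ g) = gradedMap θ (completeHom R g) :=
  substHom_weightedMap _ (fun i => complete_mem_range (i + 1)) θ g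

theorem coeff_omegaTilde (f : SymPowerSeries R) (J : ℕ →₀ ℕ) :
    coeff J (omegaTilde R f : MvPowerSeries ℕ R) =
      (-1) ^ J.degree * coeff J (omega R f : MvPowerSeries ℕ R) := rfl

/-- Expressed in the coordinates `e_i`, the map `ω` replaces `e`-monomials by `h`-monomials of the
same weight, all with integer coefficients; the degree flip only adds signs, which additive maps
respect. Used with `cutoff` for the filtration and with the Adams operations of `R`. -/
theorem omegaTilde_gradedMap (θ : ℕ → R →+ R) (f : SymPowerSeries R) :
    omegaTilde R (gradedMap θ f) = gradedMap θ (omegaTilde R f) := by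
  obtain ⟨g, rfl⟩ := elemHom_surjective f
  apply Subtype.ext
  ext J
  rw [coeff_gradedMap, coeff_omegaTilde, coeff_omegaTilde, ← elemHom_weightedMap, omega_elemHom,
    omega_elemHom, completeHom_weightedMap, coeff_gradedMap]
  rcases neg_one_pow_eq_or R J.degree with h | h <;> simp [h]

theorem elem_zero : elem R 0 = 1 := by
  classical
  apply Subtype.ext
  ext J
  change ite _ _ _ = coeff J (1 : MvPowerSeries ℕ R)
  rw [coeff_one]
  refine if_congr ⟨fun h => (Finsupp.degree_eq_zero_iff J).1 h.1, ?_⟩ rfl rfl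
  rintro rfl
  simp

theorem complete_zero : complete R 0 = 1 := by
  classical
  apply Subtype.ext
  ext J
  change ite _ _ _ = coeff J (1 : MvPowerSeries ℕ R)
  rw [coeff_one]
  exact if_congr (Finsupp.degree_eq_zero_iff J) rfl rfl

theorem omegaTilde_elem (k : ℕ) : omegaTilde R (elem R k) = (-1) ^ k * complete R k := by
  have h : omegaTilde R (elem R k) = degreeFlip R (complete R k) := by
    cases k with
    | zero =>
      rw [elem_zero, complete_zero, map_one, map_one]
    | succ k => exact congrArg (degreeFlip R) (omega_elem k)
  rw [h]
  apply Subtype.ext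
  have hc : (((-1) ^ k * complete R k : SymPowerSeries R) : MvPowerSeries ℕ R) =
      C ((-1) ^ k) * (complete R k : MvPowerSeries ℕ R) := by simp
  ext J
  rw [hc, coeff_C_mul]
  change (-1) ^ J.degree * coeff J (complete R k : MvPowerSeries ℕ R) = _
  by_cases hJ : J.degree = k
  · rw [hJ]
  · have : coeff J (complete R k : MvPowerSeries ℕ R) = 0 := if_neg hJ
    rw [this, mul_zero, mul_zero]

end GradedMap

/-! ### Degree filtration and density of polynomials in the `e_i` -/

section Fil

/-- The identity in degrees less than `N`, and zero in the other degrees. -/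
def cutoff (R : Type*) [CommRing R] (N k : ℕ) : R →+ R := if k < N then AddMonoidHom.id R else 0

/-- Turns the filtration condition into an equation that `omegaTilde_gradedMap` can transport. -/
theorem mem_fil_iff {N : ℕ} {f : SymPowerSeries R} :
    f ∈ fil R N ↔ gradedMap (cutoff R N) f = 0 := by
  constructor
  · intro hf
    apply Subtype.ext
    ext J
    rw [coeff_gradedMap, cutoff]
    split_ifs with h
    · exact hf J h
    · rfl
  · intro hf J hJ
    have h : coeff J (gradedMap (cutoff R N) f : MvPowerSeries ℕ R) = 0 := by rw [hf]; rfl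
    rwa [coeff_gradedMap, cutoff, if_pos hJ] at h

theorem omegaTilde_mem_fil {N : ℕ} {f : SymPowerSeries R} (hf : f ∈ fil R N) :
    omegaTilde R f ∈ fil R N := by
  rw [mem_fil_iff] at hf ⊢
  rw [← omegaTilde_gradedMap, hf, map_zero]

theorem frobenius_mem_fil (n : ℕ) {N : ℕ} {f : SymPowerSeries R} (hf : f ∈ fil R N) :
    frobenius R n f ∈ fil R N := by
  classical
  intro J hJ
  rw [coe_frobenius, coeff_expand_eq_sum n _ J _ le_rfl, map_sum]
  refine Finset.sum_eq_zero fun I hI => ?_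
  have hI : I.degree ≤ J.degree := Finsupp.degree_mono (Finset.mem_Iic.1 hI)
  rw [hf I (lt_of_le_of_lt hI hJ), map_zero, map_zero]

theorem sub_gradedMap_cutoff_mem_fil (N : ℕ) (f : SymPowerSeries R) :
    f - gradedMap (cutoff R N) f ∈ fil R N := by
  intro J hJ
  rw [AddSubgroupClass.coe_sub, map_sub, coeff_gradedMap, cutoff, if_pos hJ]
  exact sub_self _

theorem eq_of_sub_mem_fil {f g : SymPowerSeries R} (h : ∀ N, f - g ∈ fil R N) : f = g := by
  apply Subtype.ext
  ext J
  have := h (J.degree + 1) J (Nat.lt_succ_self _)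
  rwa [AddSubgroupClass.coe_sub, map_sub, sub_eq_zero] at this

/-- As `X_i` has weight `i + 1`, only finitely many exponents have weight below `N`, even with
infinitely many variables. -/
theorem exists_weightedMap_cutoff_eq (N : ℕ) (g : MvPowerSeries ℕ R) :
    ∃ p : MvPolynomial ℕ R, weightedMap (cutoff R N) g = p := by
  classical
  let s : Finset (ℕ →₀ ℕ) := (Finset.range N).biUnion fun k => (exps k).image emb
  have hs : ∀ m, m ∈ s ↔ wt m < N := by
    intro m
    simp only [s, Finset.mem_biUnion, Finset.mem_range, Finset.mem_image]
    constructor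
    · rintro ⟨k, hk, m', hm', rfl⟩
      rwa [mem_exps.1 hm']
    · intro h
      obtain ⟨m', hm'⟩ := exists_emb_of_wt m
      exact ⟨wt m, h, m', mem_exps.2 (by rw [hm']), hm'⟩
  refine ⟨∑ m ∈ s, MvPolynomial.monomial m (coeff m g), ?_⟩
  ext m
  rw [MvPolynomial.coeff_coe, MvPolynomial.coeff_sum]
  simp only [MvPolynomial.coeff_monomial, Finset.sum_ite_eq', hs, coeff_weightedMap, cutoff]
  split_ifs <;> rfl

/-- Algebra endomorphisms of `Λ_R^∧` that preserve the degree filtration are determined by the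
images of the elementary symmetric functions. -/
theorem algHom_ext {A B : SymPowerSeries R →ₐ[R] SymPowerSeries R}
    (hA : ∀ N, ∀ f ∈ fil R N, A f ∈ fil R N) (hB : ∀ N, ∀ f ∈ fil R N, B f ∈ fil R N)
    (h : ∀ i, A (elem R (i + 1)) = B (elem R (i + 1))) : A = B := by
  ext1 f
  refine eq_of_sub_mem_fil fun N => ?_
  have hpoly : (A.comp (elemHom R)).comp (MvPolynomial.coeToMvPowerSeries.algHom R) =
      (B.comp (elemHom R)).comp (MvPolynomial.coeToMvPowerSeries.algHom R) := by
    apply MvPolynomial.algHom_ext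
    intro i
    have hX : elemHom R (X i) = elem R (i + 1) :=
      substHom_X (fun i => elem_isHomogeneous (i + 1)) i
    simp only [AlgHom.comp_apply, MvPolynomial.coeToMvPowerSeries.algHom_apply,
      MvPolynomial.coe_X, map_X, hX, h, Algebra.algebraMap_self]
  -- The truncation of `f` below degree `N` is a polynomial in the `e_i`, where algebra maps are
  -- determined by generators; the rest of `f` lies in `Fil^N`, which both maps preserve.
  have hc : A (gradedMap (cutoff R N) f) = B (gradedMap (cutoff R N) f) := by
    obtain ⟨g, rfl⟩ := elemHom_surjective f
    obtain ⟨p, hp⟩ := exists_weightedMap_cutoff_eq N g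
    rw [← elemHom_weightedMap, hp]
    simpa [AlgHom.comp_apply, MvPolynomial.coeToMvPowerSeries.algHom_apply] using
      DFunLike.congr_fun hpoly p
  have hf := sub_gradedMap_cutoff_mem_fil N f
  have := sub_mem (hA N _ hf) (hB N _ hf)
  rwa [map_sub, map_sub, hc, sub_sub_sub_cancel_right] at this

end Fil

end SymPowerSeries

namespace SymPowerSeries

variable {R : Type*} [CommRing R]

/-! ### Power sums and Newton's identities -/

section PowerSum

open Classical in
/-- The power sum `p_{k + 1}`. -/
noncomputable def powerSum (R : Type*) [CommRing R] (k : ℕ) : SymPowerSeries R :=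
  ⟨fun J => if ∃ i, J = Finsupp.single i (k + 1) then 1 else 0, mk_mem _ fun e J => by
    refine if_congr ⟨?_, ?_⟩ rfl rfl
    · rintro ⟨i, hi⟩
      refine ⟨e.symm i, Finsupp.mapDomain_injective e.injective ?_⟩
      rw [hi, Finsupp.mapDomain_single, e.apply_symm_apply]
    · rintro ⟨i, rfl⟩
      exact ⟨e i, Finsupp.mapDomain_single⟩⟩

open Classical in
theorem coeff_powerSum (k : ℕ) (J : ℕ →₀ ℕ) :
    coeff J (powerSum R k : MvPowerSeries ℕ R) =
      if ∃ i, J = Finsupp.single i (k + 1) then 1 else 0 := rfl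

/-- Because `powerSum R k` is `p_{k+1}`, the index on the right encodes `(n+1)(k+1) - 1`. -/
theorem frobenius_powerSum (n k : ℕ) :
    frobenius R n (powerSum R k) = powerSum R ((n + 1) * k + n) := by
  classical
  apply Subtype.ext
  ext J
  have hnk : (n + 1) * k + n + 1 = (n + 1) * (k + 1) := by ring
  rw [coe_frobenius, coeff_powerSum]
  by_cases h : ∀ i, n + 1 ∣ J i
  · obtain ⟨I, rfl⟩ : ∃ I, (n + 1) • I = J :=
      ⟨J.mapRange (· / (n + 1)) (Nat.zero_div _), by
        ext i
        simpa using Nat.mul_div_cancel' (h i)⟩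
    rw [coeff_expand_smul, coeff_powerSum]
    refine if_congr (exists_congr fun i => ?_) rfl rfl
    rw [hnk, ← smul_eq_mul, ← Finsupp.smul_single]
    exact (nsmul_right_injective n.succ_ne_zero).eq_iff.symm
  · push Not at h
    obtain ⟨j, hj⟩ := h
    rw [coeff_expand_of_not_dvd _ _ _ hj, if_neg]
    rintro ⟨i, rfl⟩
    refine hj ?_
    rw [hnk, Finsupp.single_apply]
    split_ifs
    · exact dvd_mul_right _ _
    · exact dvd_zero _

theorem killCompl_powerSum (n k : ℕ) :
    killCompl (Fin.valEmbedding (n := n)) (powerSum R k : MvPowerSeries ℕ R) =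
      (MvPolynomial.psum (Fin n) R (k + 1) : MvPowerSeries (Fin n) R) := by
  classical
  ext J
  rw [coeff_killCompl, MvPolynomial.coeff_coe, MvPolynomial.psum, MvPolynomial.coeff_sum,
    coeff_powerSum]
  simp only [MvPolynomial.coeff_X_pow]
  by_cases h : ∃ i, Finsupp.single i (k + 1) = J
  · obtain ⟨i, rfl⟩ := h
    rw [if_pos ⟨i, Finsupp.embDomain_single _ _ _⟩, Finset.sum_eq_single i, if_pos rfl]
    · intro j _ hj
      exact if_neg fun h => hj (Finsupp.single_left_injective k.succ_ne_zero h)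
    · simp
  · rw [if_neg, Finset.sum_eq_zero fun i _ => if_neg fun hi => h ⟨i, hi⟩]
    rintro ⟨i, hi⟩
    have hmem : i ∈ (Finsupp.embDomain (Fin.valEmbedding (n := n)) J).support := by
      rw [hi]; simp
    rw [Finsupp.support_embDomain, Finset.mem_map] at hmem
    obtain ⟨j, _, rfl⟩ := hmem
    rw [← Finsupp.embDomain_single] at hi
    exact h ⟨j, (Finsupp.embDomain_injective _ hi).symm⟩

/-- Every monomial involves finitely many variables, so it survives setting `t_i = 0` for `i ≥ n`
once `n` is large. This reduces identities to symmetric polynomials. -/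
theorem eq_of_killCompl_eq {f g : SymPowerSeries R}
    (h : ∀ n, killCompl (Fin.valEmbedding (n := n)) (f : MvPowerSeries ℕ R) =
      killCompl (Fin.valEmbedding (n := n)) (g : MvPowerSeries ℕ R)) : f = g := by
  apply Subtype.ext
  ext J
  obtain ⟨J', hJ'⟩ := exists_emb_eq (n := J.support.sup id + 1) (m := J) fun i hi =>
    Nat.lt_succ_of_le (Finset.le_sup (f := id) (Finsupp.mem_support_iff.2 hi))
  rw [← hJ']
  exact congrArg (coeff J') (h _)

/-- Newton's identity for the elementary symmetric functions. -/
theorem succ_mul_elem (k : ℕ) :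
    ((k : SymPowerSeries R) + 1) * elem R (k + 1) =
      ∑ ij ∈ Finset.HasAntidiagonal.antidiagonal k, (-1) ^ ij.2 * elem R ij.1 * powerSum R ij.2 := by
  classical
  refine eq_of_killCompl_eq fun n => ?_
  have h := MvPolynomial.mul_esymm_eq_sum (Fin n) R (k + 1)
  -- The polynomial identity sums over `(i, j)` with `i + j = k + 1` and `j > 0`; the shift `j ↦ j +
  -- 1` matches the indexing of `powerSum`.
  have hfil : {a ∈ Finset.HasAntidiagonal.antidiagonal (k + 1) | a.1 < k + 1} =
      (Finset.HasAntidiagonal.antidiagonal k).map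
        ((Function.Embedding.refl ℕ).prodMap ⟨Nat.succ, Nat.succ_injective⟩) := by
    ext ⟨i, j⟩
    simp only [Finset.mem_filter, Finset.HasAntidiagonal.mem_antidiagonal, Finset.mem_map,
      Prod.exists, Function.Embedding.prodMap, Function.Embedding.coeFn_mk, Prod.map,
      Function.Embedding.refl_apply, Prod.mk.injEq]
    constructor
    · rintro ⟨h1, h2⟩
      exact ⟨i, j - 1, by omega, rfl, by omega⟩
    · rintro ⟨a, b, h1, rfl, rfl⟩
      exact ⟨by omega, by omega⟩
  rw [hfil, Finset.sum_map, Finset.mul_sum] at h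
  have h := congrArg (fun p : MvPolynomial (Fin n) R =>
    MvPolynomial.coeToMvPowerSeries.ringHom p) h
  simp only [map_mul, map_sum, map_natCast, map_pow, map_neg, map_one,
    MvPolynomial.coeToMvPowerSeries.ringHom_apply, Function.Embedding.prodMap,
    Function.Embedding.coeFn_mk, Prod.map, Function.Embedding.refl_apply, Nat.succ_eq_add_one,
    ← killCompl_elem, ← killCompl_powerSum] at h
  simp only [MulMemClass.coe_mul, AddSubmonoidClass.coe_finsetSum, AddMemClass.coe_add,
    SubmonoidClass.coe_pow, NegMemClass.coe_neg, OneMemClass.coe_one, SubringClass.coe_natCast,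
    map_mul, map_sum, map_add, map_pow, map_neg, map_one, map_natCast]
  push_cast at h
  rw [h]
  refine Finset.sum_congr rfl fun ij hij => ?_
  rw [← Finset.HasAntidiagonal.mem_antidiagonal.1 hij, ← mul_assoc, ← mul_assoc, ← pow_add]
  congr 2
  rw [show ij.1 + ij.2 + 1 + 1 + ij.1 = 2 * (ij.1 + 1) + ij.2 by ring, pow_add, pow_mul]
  simp

theorem coeff_mul_powerSum (f : MvPowerSeries ℕ R) (k : ℕ) (J : ℕ →₀ ℕ) :
    coeff J (f * (powerSum R k : MvPowerSeries ℕ R)) =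
      ∑ i ∈ J.support, if k + 1 ≤ J i then coeff (J - Finsupp.single i (k + 1)) f else 0 := by
  classical
  have hinj : Function.Injective fun i : ℕ => Finsupp.single i (k + 1) :=
    Finsupp.single_left_injective k.succ_ne_zero
  rw [coeff_mul, ← Finset.sum_filter]
  have h : ∀ i ∈ {i ∈ J.support | k + 1 ≤ J i}, coeff (J - Finsupp.single i (k + 1)) f =
      coeff (J - Finsupp.single i (k + 1)) f *
        coeff (Finsupp.single i (k + 1)) (powerSum R k : MvPowerSeries ℕ R) := by
    intro i _
    rw [coeff_powerSum, if_pos ⟨i, rfl⟩, mul_one]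
  rw [Finset.sum_congr rfl h]
  symm
  refine Finset.sum_of_injOn
    (fun i => (J - Finsupp.single i (k + 1), Finsupp.single i (k + 1)))
    (fun i _ j _ hij => hinj (Prod.mk.inj hij).2) ?_ ?_ fun _ _ => rfl
  · intro i hi
    have hi := (Finset.mem_filter.1 hi).2
    exact Finset.HasAntidiagonal.mem_antidiagonal.2
      (tsub_add_cancel_of_le (Finsupp.single_le_iff.2 hi))
  · rintro ⟨K, L⟩ hKL hnot
    rw [coeff_powerSum, if_neg, mul_zero]
    rintro ⟨i, rfl⟩
    have hKL := Finset.HasAntidiagonal.mem_antidiagonal.1 hKL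
    have hle : k + 1 ≤ J i := by
      rw [← hKL]; simp
    refine hnot ⟨i, Finset.mem_coe.2 (Finset.mem_filter.2 ⟨?_, hle⟩), ?_⟩
    · exact Finsupp.mem_support_iff.2 (by omega)
    · simp only [← hKL, add_tsub_cancel_right]

/-- Newton's identity for the complete symmetric functions. -/
theorem succ_mul_complete (k : ℕ) :
    ((k : SymPowerSeries R) + 1) * complete R (k + 1) =
      ∑ ij ∈ Finset.HasAntidiagonal.antidiagonal k, complete R ij.1 * powerSum R ij.2 := by
  classical
  have hcomp : ∀ (n : ℕ) (K : ℕ →₀ ℕ), coeff K (complete R n : MvPowerSeries ℕ R) =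
      if K.degree = n then 1 else 0 := fun _ _ => rfl
  apply Subtype.ext
  have hl : ((((k : SymPowerSeries R) + 1) * complete R (k + 1) : SymPowerSeries R) :
      MvPowerSeries ℕ R) = C ((k : R) + 1) * (complete R (k + 1) : MvPowerSeries ℕ R) := by
    simp
  ext J
  rw [hl, coeff_C_mul, hcomp, AddSubmonoidClass.coe_finsetSum, map_sum]
  simp only [MulMemClass.coe_mul, coeff_mul_powerSum, hcomp]
  rw [Finset.sum_comm]
  -- For `J` of degree `k + 1`, the variable `t_i` can be split off as a power `t_i^j` with `1 ≤ j ≤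
  -- J i`, hence in `J i` ways. Summing over `i` gives the degree `k + 1`.
  have hin : ∀ i ∈ J.support, (∑ ij ∈ Finset.HasAntidiagonal.antidiagonal k,
      if ij.2 + 1 ≤ J i then
        (if (J - Finsupp.single i (ij.2 + 1)).degree = ij.1 then (1 : R) else 0) else 0) =
      if J.degree = k + 1 then (J i : R) else 0 := by
    intro i _
    have hJi : J i ≤ J.degree := Finsupp.le_degree i J
    have hdeg : ∀ ij ∈ Finset.HasAntidiagonal.antidiagonal k, (if ij.2 + 1 ≤ J i then
        (if (J - Finsupp.single i (ij.2 + 1)).degree = ij.1 then (1 : R) else 0) else 0) =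
        if J.degree = k + 1 then (if ij.2 + 1 ≤ J i then 1 else 0) else 0 := by
      intro ij hij
      have hij := Finset.HasAntidiagonal.mem_antidiagonal.1 hij
      by_cases hle : ij.2 + 1 ≤ J i
      · have hd := congrArg Finsupp.degree
          (tsub_add_cancel_of_le (Finsupp.single_le_iff.2 hle))
        rw [map_add, Finsupp.degree_single] at hd
        rw [if_pos hle, if_pos hle]
        exact if_congr (by omega) rfl rfl
      · simp only [if_neg hle, ite_self]
    rw [Finset.sum_congr rfl hdeg]
    split_ifs with hJ
    · rw [← Finset.Nat.sum_antidiagonal_swap,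
        Finset.Nat.sum_antidiagonal_eq_sum_range_succ_mk, Finset.sum_boole]
      congr 1
      have : {x ∈ Finset.range k.succ | x + 1 ≤ J i} = Finset.range (J i) := by
        ext x
        simp only [Finset.mem_filter, Finset.mem_range]
        omega
      simp only [Prod.swap, this, Finset.card_range]
    · exact Finset.sum_const_zero
  rw [Finset.sum_congr rfl hin]
  split_ifs with hJ
  · rw [mul_one, ← Nat.cast_sum, ← Finsupp.degree_apply, hJ, Nat.cast_succ]
  · rw [mul_zero, Finset.sum_const_zero]

theorem neg_one_pow_mul_cancel {A : Type*} [CommRing A] {n : ℕ} {x y : A}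
    (h : (-1) ^ n * x = (-1) ^ n * y) : x = y :=
  ((isUnit_one (M := A)).neg.pow n).mul_left_cancel h

/-- Applying `ω̃` to Newton's identity for the `e_i` and comparing with the one for the `h_i` gives
two expansions of `(k+1) h_{k+1}`. By induction they agree except in the term `h_0 p_{k+1}`, whose
coefficient is `1`, so no division is needed. -/
theorem omegaTilde_powerSum (k : ℕ) : omegaTilde R (powerSum R k) = -powerSum R k := by
  induction k using Nat.strong_induction_on with
  | _ k ih =>
    have h := congrArg (omegaTilde R) (succ_mul_elem (R := R) k)
    simp only [map_mul, map_add, map_natCast, map_one, map_sum, map_pow, map_neg,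
      omegaTilde_elem] at h
    have h1 : ((k : SymPowerSeries R) + 1) * ((-1) ^ (k + 1) * complete R (k + 1)) =
        (-1) ^ (k + 1) * ∑ ij ∈ Finset.HasAntidiagonal.antidiagonal k,
          complete R ij.1 * powerSum R ij.2 := by
      rw [← succ_mul_complete]
      ring
    -- The signs combine to `(-1)^k`, one less than the exponent in `h1`; the leftover `-1` goes to
    -- the image of the power sum.
    have h2 : ∀ ij ∈ Finset.HasAntidiagonal.antidiagonal k,
        (-1) ^ ij.2 * ((-1) ^ ij.1 * complete R ij.1) * omegaTilde R (powerSum R ij.2) =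
        (-1) ^ (k + 1) * (complete R ij.1 * -omegaTilde R (powerSum R ij.2)) := by
      intro ij hij
      rw [← Finset.HasAntidiagonal.mem_antidiagonal.1 hij]
      ring
    rw [h1, Finset.sum_congr rfl h2, ← Finset.mul_sum] at h
    have h := neg_one_pow_mul_cancel h
    have hmem : (0, k) ∈ Finset.HasAntidiagonal.antidiagonal k := by simp
    have h3 : ∀ ij ∈ (Finset.HasAntidiagonal.antidiagonal k).erase (0, k),
        complete R ij.1 * -omegaTilde R (powerSum R ij.2) =
        complete R ij.1 * powerSum R ij.2 := by
      rintro ⟨i, j⟩ hij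
      obtain ⟨hne, hij⟩ := Finset.mem_erase.1 hij
      have hij := Finset.HasAntidiagonal.mem_antidiagonal.1 hij
      simp only at hij ⊢
      rw [ih j (lt_of_le_of_ne (by omega) ?_), neg_neg]
      rintro rfl
      exact hne (by rw [Nat.add_eq_right.1 hij])
    rw [← Finset.add_sum_erase _ _ hmem, ← Finset.add_sum_erase _ _ hmem,
      Finset.sum_congr rfl h3] at h
    have h := add_right_cancel h
    simp only [complete_zero, one_mul] at h
    exact (neg_eq_iff_eq_neg.2 h).symm

end PowerSum

end SymPowerSeries

namespace SymPowerSeries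

variable {R : Type*} [CommRing R]

/-! ### Compatibility of `ω̃` with the substitution `t_i ↦ t_i^{n+1}` -/

theorem isAddTorsionFree [IsAddTorsionFree R] : IsAddTorsionFree (SymPowerSeries R) where
  nsmul_right_injective n hn f g h := by
    apply Subtype.ext
    ext J
    have h := congrArg (fun x : SymPowerSeries R => coeff J (x : MvPowerSeries ℕ R)) h
    exact nsmul_right_injective hn h

/-- Both composites send `p_k` to `-p_{(n+1)k}`; Newton's identity passes the agreement on to the
`e_k` inductively, dividing by `k`. -/
theorem omegaTilde_comp_frobenius [IsAddTorsionFree R] (n : ℕ) :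
    (omegaTilde R).comp (frobenius R n) = (frobenius R n).comp (omegaTilde R) := by
  have : IsAddTorsionFree (SymPowerSeries R) := isAddTorsionFree
  refine algHom_ext (fun N f hf => omegaTilde_mem_fil (frobenius_mem_fil n hf))
    (fun N f hf => frobenius_mem_fil n (omegaTilde_mem_fil hf)) fun i => ?_
  -- Newton's recursion reaches down to `e_0 = 1`, so the induction has to include index `0`.
  generalize i + 1 = k
  induction k using Nat.strong_induction_on with
  | _ k ih =>
    cases k with
    | zero => rw [elem_zero, map_one, map_one]
    | succ k =>
      have hA := congrArg ((omegaTilde R).comp (frobenius R n)) (succ_mul_elem (R := R) k)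
      have hB := congrArg ((frobenius R n).comp (omegaTilde R)) (succ_mul_elem (R := R) k)
      have hp : ∀ j, (omegaTilde R).comp (frobenius R n) (powerSum R j) =
          (frobenius R n).comp (omegaTilde R) (powerSum R j) := by
        intro j
        rw [AlgHom.comp_apply, AlgHom.comp_apply, omegaTilde_powerSum, map_neg,
          frobenius_powerSum, omegaTilde_powerSum]
      simp only [map_mul, map_add, map_natCast, map_one, map_sum, map_pow, map_neg] at hA hB
      have hAB := hA.trans ((Finset.sum_congr rfl fun ij hij => by
        have hij := Finset.HasAntidiagonal.mem_antidiagonal.1 hij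
        rw [ih ij.1 (by omega), hp]).trans hB.symm)
      refine nsmul_right_injective k.succ_ne_zero ?_
      simpa only [nsmul_eq_mul, Nat.cast_succ] using hAB

/-! ### Conclusion for the `σ`-operations and `Exp_σ` -/

section Sigma

variable [PreLambdaRing R]

/-- The Adams operation `ψ_{n + 1}` of `Λ_R^∧`. -/
noncomputable def adamsSym (n : ℕ) (f : SymPowerSeries R) : SymPowerSeries R :=
  frobenius R n (gradedMap (fun _ => PreLambdaRing.adams R n) f)

theorem σ_succ_mul (n : ℕ) (f : SymPowerSeries R) :
    PreLambdaRing.σ (n + 1) f * ((n : SymPowerSeries R) + 1) =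
      ∑ ij ∈ Finset.HasAntidiagonal.antidiagonal n, PreLambdaRing.σ ij.1 f * adamsSym ij.2 f := by
  apply Subtype.ext
  have h := congrArg (PowerSeries.coeff n) (derivative_mk_sigmaFun (f : MvPowerSeries ℕ R))
  rw [PowerSeries.coeff_derivative, PowerSeries.coeff_mul] at h
  simp only [PowerSeries.coeff_mk] at h
  rw [AddSubmonoidClass.coe_finsetSum]
  simp only [MulMemClass.coe_mul]
  exact h

theorem omegaTilde_adamsSym [IsAddTorsionFree R] (n : ℕ) (f : SymPowerSeries R) :
    omegaTilde R (adamsSym n f) = adamsSym n (omegaTilde R f) := by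
  rw [adamsSym, adamsSym, ← omegaTilde_gradedMap]
  exact DFunLike.congr_fun (omegaTilde_comp_frobenius n) _

/-- Applying `ω̃` to the recursion for `f` shows that `∑ ω̃(σ_k f) t^k` has logarithmic derivative
`∑ ψ_{n+1}(ω̃ f) t^n`, the same as `σ_t(ω̃ f)`. Constant term `1` and torsion-freeness then force
equality. -/
theorem omegaTilde_σ [IsAddTorsionFree R] (k : ℕ) (f : SymPowerSeries R) :
    omegaTilde R (PreLambdaRing.σ k f) = PreLambdaRing.σ k (omegaTilde R f) := by
  have : IsAddTorsionFree (SymPowerSeries R) := isAddTorsionFree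
  have h : (PowerSeries.mk fun k => omegaTilde R (PreLambdaRing.σ k f)) =
      PreLambdaRing.sigmaSeries (omegaTilde R f) := by
    refine PreLambdaRing.eq_of_derivative_eq_mul
      (P := PowerSeries.mk fun n => adamsSym n (omegaTilde R f)) ?_ ?_ ?_ ?_
    · rw [PowerSeries.coeff_mk, PreLambdaRing.σ_zero, map_one]
    · rw [PreLambdaRing.coeff_sigmaSeries, PreLambdaRing.σ_zero]
    · ext1 n
      have hn := congrArg (omegaTilde R) (σ_succ_mul n f)
      simp only [map_mul, map_add, map_natCast, map_one, map_sum, omegaTilde_adamsSym] at hn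
      rw [PowerSeries.coeff_derivative, PowerSeries.coeff_mul]
      simpa only [PowerSeries.coeff_mk] using hn
    · ext1 n
      rw [PowerSeries.coeff_derivative, PowerSeries.coeff_mul]
      simpa only [PowerSeries.coeff_mk, PreLambdaRing.coeff_sigmaSeries] using
        σ_succ_mul n (omegaTilde R f)
  have := congrArg (PowerSeries.coeff k) h
  rwa [PowerSeries.coeff_mk, PreLambdaRing.coeff_sigmaSeries] at this

theorem Exp_sub_sum_mem_fil {f : SymPowerSeries R} (hf : f ∈ fil R 1) (N : ℕ) :
    Exp f - ∑ k ∈ Finset.range N, PreLambdaRing.σ k f ∈ fil R N := by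
  intro J hJ
  rw [AddSubgroupClass.coe_sub, map_sub, AddSubmonoidClass.coe_finsetSum, map_sum, sub_eq_zero]
  -- The coefficient of `Exp f` at `t^J` stops at `k = deg J`, and the further terms with `k < N`
  -- vanish there since `σ_k f` lies in `Fil^k`.
  refine Finset.sum_subset (Finset.range_subset_range.2 hJ) fun k _ hk => ?_
  exact sigma_mem_fil hf k J (by simpa [Nat.lt_succ_iff] using hk)

/-- Modulo `Fil^N` both sides are the same partial sum `∑_{k < N} σ_k(ω̃ f)`, and the filtration is
separated. -/
theorem omegaTilde_Exp [IsAddTorsionFree R] {f : SymPowerSeries R} (hf : f ∈ fil R 1) :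
    omegaTilde R (Exp f) = Exp (omegaTilde R f) := by
  refine eq_of_sub_mem_fil fun N => ?_
  have h1 := omegaTilde_mem_fil (Exp_sub_sum_mem_fil hf N)
  have h2 := Exp_sub_sum_mem_fil (omegaTilde_mem_fil hf) N
  rw [map_sub, map_sum, Finset.sum_congr rfl fun k _ => omegaTilde_σ k f] at h1
  simpa only [sub_sub_sub_cancel_right] using sub_mem h1 h2

end Sigma

end SymPowerSeries

theorem mainTheorem2 {R : Type*} [CommRing R] [PreLambdaRing R] [IsAddTorsionFree R] :
    IsPreLambdaHom (SymPowerSeries.omegaTilde R).toRingHom ∧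
      ∀ f ∈ SymPowerSeries.fil R 1,
        SymPowerSeries.omegaTilde R f ∈ SymPowerSeries.fil R 1 ∧
        SymPowerSeries.omegaTilde R (SymPowerSeries.Exp f) =
          SymPowerSeries.Exp (SymPowerSeries.omegaTilde R f) :=
  ⟨SymPowerSeries.omegaTilde_σ, fun _ hf =>
    ⟨SymPowerSeries.omegaTilde_mem_fil hf, SymPowerSeries.omegaTilde_Exp hf⟩⟩
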